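/- **Definitions.** All graphs are finite and simple. For a graph $G$ on $n$ vertices let $\Lambda_{4,3}(G)$ be the number of $4$-subsets of $V(G)$ that span exactly $3$ edges, and, for $n\ge 4$, let $\lambda_{4,3}(G)=\Lambda_{4,3}(G)/\binom n4$ and let $\lambda_{4,3}(n)$ be the maximum of $\lambda_{4,3}(G)$ over all graphs $G$ with $n$ vertices. The $(4,3)$-edge-inducibility constant is $\lambda_{4,3}:=\lim_{n\to\infty}\lambda_{4,3}(n)$. A pattern $B$ on $\{0,1\}$ is a graph on $\{0,1\}$ that may have loops. For disjoint (possibly empty) sets $V_0,V_1$, the blowup $B(V_0,V_1)$ is the graph on $V_0\cup V_1$ in which distinct $x\in V_i$ and $y\in V_j$ are adjacent if and only if $ij\in E(B)$. For $x_0,x_1\ge 0$ with $x_0+x_1=1$, $\lambda_{4,3}(B(x_0,x_1))$ denotes the limit, as $n\to\infty$, of $\lambda_{4,3}(B(V_0,V_1))$ where $|V_0|+|V_1|=n$ and $|V_i|=(x_i+o(1))n$ for $i=0,1$ (independently of the choice of such sets). For graphs $F$ and $G$, $P(F,G)$ is the number of $|V(F)|$-subsets of $V(G)$ that induce a subgraph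 isomorphic to $F$. A type $\tau$ is a graph on $\{0,\dots,q-1\}$. A $\tau$-flag $(F,f)$ is a graph $F$ with an injection $f:\{0,\dots,q-1\}\to V(F)$ that preserves edges and non-edges of $\tau$; isomorphisms of $\tau$-flags are graph isomorphisms that respect these injections. Let $\mathcal F_N^0$ be the set of $N$-vertex graphs up to isomorphism and $\mathcal F_s^\tau$ the set of $s$-vertex $\tau$-flags up to isomorphism. For a $\tau$-flag $(H,h)$, let $\mathbf V^{\tau,s}_{(H,h)}\in\mathbb R^{\mathcal F_s^\tau}$ be the vector whose $(F,f)$-entry is the number of $(s-q)$-subsets $X$ of $V(H)\setminus h(\{0,\dots,q-1\})$ for which $(H[X\cup h(\{0,\dots,q-1\})],h)$ is isomorphic to $(F,f)$. A flag algebra certificate on $N\ge 4$ vertices for the bound $\lambda_{4,3}\le u$ consists of real symmetric positive semi-definite matrices $X^\tau$, indexed by $\mathcal F^\tau_{(N+q)/2}$, for all types $\tau$ with $q$ vertices, where $1\le q\le N-2$ and $q\equiv N \pmod 2$ (with $X^\tau\neq 0$ for at most one type from each isomorphism class of graphs), and of reals $c_F\ge 0$ for $F\in\mathcal F_N^0$,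 such that, for all graphs $G$ with $n$ vertices, $$\sum_{F\in\mathcal F_N^0}\bigl(u-\lambda_{4,3}(F)\bigr)P(F,G)=\sum_{\substack{1\le q\le N-2\\ q\equiv N\ (\mathrm{mod}\ 2)}}\ \sum_{f}\bigl(\mathbf V_{(G,f)}^{\tau,s}\bigr)^{T}X^\tau\,\mathbf V_{(G,f)}^{\tau,s}+\sum_{F\in\mathcal F_N^0}c_F\,P(F,G)+O(n^{N-1}),$$ where $f$ runs over all injections $\{0,\dots,q-1\}\to V(G)$, $\tau$ is the graph on $\{0,\dots,q-1\}$ for which $(G,f)$ is a $\tau$-flag, $s=(N+q)/2$, and the implied constant does not depend on $G$ or $n$. **Theorem.** The limit $\lambda_{4,3}$ exists and equals $1/2$. Let $B$ be the pattern with edge set $\{00,11\}$ (two loops; its blowups are the disjoint unions of two cliques) or the pattern with edge set $\{01\}$ (a single edge; its blowups are the complete bipartite graphs). In both cases $\lambda_{4,3}(B(x_0,x_1))$ exists for all $x_0,x_1\ge0$ with $x_0+x_1=1$, it equals $1/2$ for $(x_0,x_1)=(1/2,1/2)$, and it is strictly smaller than $1/2$ for every other $(x_0,x_1)$. Moreover,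 there is a flag algebra certificate on $N=6$ vertices for the bound $\lambda_{4,3}\le 1/2$. -/

import Mathlib

open Filter Topology

namespace EdgeInd

noncomputable section

open scoped Classical in
/-- `Λ_{κ,ℓ}(G)`: the number of `κ`-subsets of the vertex set that span exactly `ℓ` edges. -/
def spanCount (κ ℓ : ℕ) {V : Type*} [Fintype V] (G : SimpleGraph V) : ℕ :=
  ((Finset.univ.powersetCard κ).filter
    (fun S : Finset V => (G.induce (S : Set V)).edgeSet.ncard = ℓ)).card

/-- `λ_{κ,ℓ}(G)`: the proportion of `κ`-subsets that span exactly `ℓ` edges. -/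
def spanDensity (κ ℓ : ℕ) {V : Type*} [Fintype V] (G : SimpleGraph V) : ℝ :=
  (spanCount κ ℓ G : ℝ) / ((Fintype.card V).choose κ : ℝ)

open scoped Classical in
/-- `Λ_{κ,ℓ}(n)`: the maximum of `Λ_{κ,ℓ}(G)` over all graphs `G` with `n` vertices. -/
def maxSpanCount (κ ℓ n : ℕ) : ℕ :=
  (Finset.univ : Finset (SimpleGraph (Fin n))).sup (fun G => spanCount κ ℓ G)

/-- `λ_{κ,ℓ}(n) = Λ_{κ,ℓ}(n) / (n choose κ)`. -/
def maxSpanDensity (κ ℓ n : ℕ) : ℝ :=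
  (maxSpanCount κ ℓ n : ℝ) / (n.choose κ : ℝ)

/-- `u` is the `(κ,ℓ)`-edge-inducibility constant: the limit of `λ_{κ,ℓ}(n)` exists and is `u`. -/
def IsEdgeInducibilityConstant (κ ℓ : ℕ) (u : ℝ) : Prop :=
  Tendsto (fun n : ℕ => maxSpanDensity κ ℓ n) atTop (𝓝 u)

/-! ### Patterns and blowups -/

/-- A pattern on `{0, …, m-1}`: a graph in which loops are allowed. -/
structure Pattern (m : ℕ) where
  Adj : Fin m → Fin m → Prop
  symm : ∀ i j, Adj i j → Adj j i

/-- Two isolated loops. -/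
def twoLoops : Pattern 2 where
  Adj i j := i = j
  symm _ _ h := h.symm

/-- Two vertices joined by an edge, no loops. -/
def singleEdge : Pattern 2 where
  Adj i j := i ≠ j
  symm _ _ h := h.symm

/-- The blowup of `B` whose parts are `V_i = {x | c x = i}`. -/
def Pattern.blowup {m : ℕ} (B : Pattern m) {V : Type*} (c : V → Fin m) : SimpleGraph V where
  Adj x y := x ≠ y ∧ B.Adj (c x) (c y)
  symm := ⟨fun _ _ h => ⟨h.1.symm, B.symm _ _ h.2⟩⟩
  loopless := ⟨fun _ h => h.1 rfl⟩

/-- `d = λ_{κ,ℓ}(B(x))`: for every choice, for each `n`, of a partition of an `n`-set into parts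
`V_0, …, V_{m-1}` with `|V_i| = (x_i + o(1)) n`, the densities `λ_{κ,ℓ}(B(V_0, …, V_{m-1}))` tend
to `d` as `n → ∞`. -/
def IsBlowupDensity (κ ℓ : ℕ) {m : ℕ} (B : Pattern m) (x : Fin m → ℝ) (d : ℝ) : Prop :=
  ∀ c : ∀ n : ℕ, Fin n → Fin m,
    (∀ i : Fin m, Tendsto (fun n : ℕ =>
      ((Finset.univ.filter (fun v : Fin n => c n v = i)).card : ℝ) / (n : ℝ)) atTop (𝓝 (x i))) →
    Tendsto (fun n : ℕ => spanDensity κ ℓ (B.blowup (c n))) atTop (𝓝 d)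

/-! ### Flag algebra certificates -/

/-- Isomorphism of graphs on `{0, …, k-1}`. -/
def isoSetoid (k : ℕ) : Setoid (SimpleGraph (Fin k)) where
  r F H := Nonempty (F ≃g H)
  iseqv := ⟨fun _ => ⟨SimpleGraph.Iso.refl⟩, fun ⟨e⟩ => ⟨e.symm⟩,
    fun ⟨e⟩ ⟨e'⟩ => ⟨e.trans e'⟩⟩

/-- Isomorphism classes of graphs with `k` vertices. -/
abbrev GraphClass (k : ℕ) : Type := Quotient (isoSetoid k)

instance (k : ℕ) : Fintype (GraphClass k) := Fintype.ofFinite _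

open scoped Classical in
/-- `P(F,G)`: the number of `k`-subsets of the vertex set of `G` that induce a copy of `F`. -/
def inducedCount {k : ℕ} (F : SimpleGraph (Fin k)) {V : Type*} [Fintype V]
    (G : SimpleGraph V) : ℕ :=
  ((Finset.univ.powersetCard k).filter
    (fun S : Finset V => Nonempty (F ≃g G.induce (S : Set V)))).card

/-- A `τ`-flag on the vertex set `V`: a graph with an embedded (labelled, induced) copy of `τ`. -/
structure TFlag {q : ℕ} (τ : SimpleGraph (Fin q)) (V : Type*) where
  graph : SimpleGraph V
  root : τ ↪g graph

/-- Isomorphism of `τ`-flags with `s` vertices: a graph isomorphism preserving each root. -/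
def TFlag.setoid {q : ℕ} (τ : SimpleGraph (Fin q)) (s : ℕ) : Setoid (TFlag τ (Fin s)) where
  r F H := ∃ e : F.graph ≃g H.graph, ∀ i, e (F.root i) = H.root i
  iseqv := by
    refine ⟨fun _ => ⟨SimpleGraph.Iso.refl, fun _ => rfl⟩, ?_, ?_⟩
    · rintro F H ⟨e, he⟩
      exact ⟨e.symm, fun i => by rw [← he i]; exact e.symm_apply_apply _⟩
    · rintro F H K ⟨e, he⟩ ⟨e', he'⟩
      exact ⟨e.trans e', fun i => by rw [← he' i, ← he i]; rfl⟩

/-- Isomorphism classes of `τ`-flags with `s` vertices. -/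
abbrev FlagClass {q : ℕ} (τ : SimpleGraph (Fin q)) (s : ℕ) : Type := Quotient (TFlag.setoid τ s)

instance {q : ℕ} (τ : SimpleGraph (Fin q)) (s : ℕ) : Finite (TFlag τ (Fin s)) := by
  refine Finite.of_injective
    (fun F : TFlag τ (Fin s) => (F.graph, fun i => F.root i)) ?_
  rintro ⟨F, f⟩ ⟨H, h⟩ hFH
  obtain ⟨h1, h2⟩ := Prod.mk.inj hFH
  dsimp only at h1 h2
  subst h1
  congr 1
  exact DFunLike.ext _ _ (fun i => congrFun h2 i)

instance {q : ℕ} (τ : SimpleGraph (Fin q)) (s : ℕ) : Fintype (FlagClass τ s) :=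
  Fintype.ofFinite _

open scoped Classical in
/-- `P((F,f),(H,h))`: the number of `(s-q)`-subsets `X` of the non-roots of `H` such that the
sub-flag of `H` on `X` together with the roots is isomorphic to `F`. -/
def flagCount {q s : ℕ} {τ : SimpleGraph (Fin q)} (F : TFlag τ (Fin s))
    {V : Type*} [Fintype V] (H : TFlag τ V) : ℕ :=
  ((Finset.univ.powersetCard (s - q)).filter (fun X : Finset V =>
    Disjoint (X : Set V) (Set.range H.root) ∧
      ∃ e : F.graph ≃g H.graph.induce ((X : Set V) ∪ Set.range H.root),
        ∀ i, (e (F.root i) : V) = H.root i)).card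

/-- The flag `(G,f)`, for an injection `f` of `{0, …, q-1}` into the vertices of `G`; its type is
the graph that `f` pulls back from `G`. -/
def rootedAt {q : ℕ} {V : Type*} (G : SimpleGraph V) (f : Fin q ↪ V) : TFlag (G.comap f) V where
  graph := G
  root := SimpleGraph.Embedding.comap f G

/-- The vector of the numbers of all `s`-vertex sub-flags of a `τ`-flag. -/
def flagVector {q : ℕ} {τ : SimpleGraph (Fin q)} (s : ℕ) {V : Type*} [Fintype V]
    (H : TFlag τ V) : FlagClass τ s → ℝ :=
  fun F => (flagCount F.out H : ℝ)

open scoped Classical in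
/-- There is a flag algebra certificate on `N` vertices for the upper bound `u` in the
`(κ,ℓ)`-problem: positive semi-definite matrices `X^τ` indexed by the `τ`-flags with `(N+q)/2`
vertices, for the types `τ` with `q` vertices, `1 ≤ q ≤ N-2`, `q ≡ N (mod 2)` (only one type from
each isomorphism class carrying a non-zero matrix) and slacks `c_F ≥ 0` for the `N`-vertex graphs
`F`, such that for all graphs `G` on `n` vertices
`∑_F (u - λ(F)) P(F,G) = ∑_q ∑_f V_{G,f}ᵀ X^τ V_{G,f} + ∑_F c_F P(F,G) + O(n^{N-1})`,
where `f` runs over the injections of `{0, …, q-1}` into the vertices of `G` and `τ` is the type of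
`(G,f)`. -/
def HasFlagCertificate (κ ℓ N : ℕ) (u : ℝ) : Prop :=
  κ ≤ N ∧
  ∃ (X : ∀ (q : ℕ) (τ : SimpleGraph (Fin q)),
      Matrix (FlagClass τ ((N + q) / 2)) (FlagClass τ ((N + q) / 2)) ℝ)
    (c : GraphClass N → ℝ),
    (∀ q τ, (X q τ).PosSemidef) ∧
    (∀ (q : ℕ) (τ τ' : SimpleGraph (Fin q)), τ ≠ τ' → Nonempty (τ ≃g τ') →
      X q τ = 0 ∨ X q τ' = 0) ∧
    (∀ F, 0 ≤ c F) ∧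
    ∃ C : ℝ, ∀ (n : ℕ) (G : SimpleGraph (Fin n)),
      |(∑ F : GraphClass N, (u - spanDensity κ ℓ F.out) * (inducedCount F.out G : ℝ))
        - ((∑ q ∈ (Finset.Icc 1 (N - 2)).filter (fun q => q ≡ N [MOD 2]),
              ∑ f : Fin q ↪ Fin n,
                flagVector ((N + q) / 2) (rootedAt G f) ⬝ᵥ
                  (X q (G.comap f)).mulVec (flagVector ((N + q) / 2) (rootedAt G f)))
            + ∑ F : GraphClass N, c F * (inducedCount F.out G : ℝ))|
        ≤ C * (n : ℝ) ^ (N - 1)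

end

end EdgeInd

namespace EdgeInd

/-! ### The squares of the certificate -/

/-! The upper bound is a sum of squares. For fixed roots `u, v`, each of the twelve functionals in
`signFeatures` is summed over pairs of further vertices and squared; this expands into a sum of
`flagProduct` over six vertices: the roots and two pairs. Symmetrising over the 15 choices of roots
and the 3 pairings of the other four vertices gives the permutation-invariant quantity `sixSquares`.
Everything rests on one finite inequality, `sixSquares + 5376 * sixSpan ≤ 40320`
(`sixSquares_add_sixSpan_le`). As 40320 = 5376 · 15/2 and squares are nonnegative, averaging shows
that asymptotically at most half of the quadruples span three edges.

The inequality is used twice. Summed over all six-tuples, repetitions allowed, it involves genuine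
squares and gives `spanCount_le` with no error term. Summed over injections, it gives
`hasFlagCertificate`: the squares differ from sums over injections only by overlapping pairs, which
cost O(n^5), and the slacks are the deficits of the inequality.

For the lower bound, colour the parts of a blowup with signs ±1. In two cliques or a complete
bipartite graph, four vertices span three edges exactly when they split 3–1, that is, when the
product of their signs is -1. Hence the density is (1 - (x₀ - x₁)^4)/2, with its unique maximum at
balance.

Three is half of six, so the problem is invariant under complementation; this is why flags with
non-adjacent roots are complemented first. On either blowup, for fixed roots, each functional is a
constant multiple of the product of the signs of the two further vertices, so its average tends to
zero at balance, as tightness requires. -/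

/-- The sign `1` of an edge or `-1` of a non-edge. -/
def edgeSign (b : Bool) : ℤ := cond b 1 (-1)

/-- The twelve linear functionals, on flags with two roots and two further vertices, whose squares
make up the certificate. The flag has a positive pair of roots, the further vertices see the roots
with the signs `a₁, a₂` and `b₁, b₂`, and `e` is the sign of the pair of further vertices. -/
def signFeatures (a₁ a₂ b₁ b₂ e : ℤ) : Fin 12 → ℤ :=
  let s := a₁ + a₂ + b₁ + b₂
  let d := a₁ + b₁ - a₂ - b₂
  let c := a₁ * a₂ * (b₁ + b₂) + b₁ * b₂ * (a₁ + a₂)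
  let c' := a₁ * b₁ * (a₂ + b₂) - a₂ * b₂ * (a₁ + b₁)
  let p₀ := 2 * (a₁ * b₂ + a₂ * b₁)
  let p₁ := 4 * e
  let p₂ := s - c
  let p₃ := (1 - e) * s
  let p₄ := s - e * c
  let q₀ := 2 * (a₁ * b₁ - a₂ * b₂)
  let q₁ := e * q₀
  let q₂ := (1 + e) * d
  let q₃ := d - e * c'
  ![4 * p₀ - 3 * p₁ - p₂ - 4 * p₃ + p₄, 5 * p₁ + p₂ + 2 * p₃, p₀ - p₂,
    2 * p₀ + p₁ - 2 * p₃ + p₄, 3 * p₀ + p₁ - 2 * p₃, 2 * p₀ - p₃ + p₄,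
    9 * q₀ - q₁ - 5 * q₂ + q₃, 2 * q₀ - 3 * q₁ + 8 * q₂ + 2 * q₃, q₀ - 2 * q₁ + 3 * q₂,
    2 * q₀ - 4 * q₂, 2 * q₀ - q₂, q₀ - q₁ + q₂ + q₃]

/-- The twelve functionals on a flag given by its adjacencies; a flag whose roots are not adjacent
is complemented first. -/
def boolFeatures (r a₁ a₂ b₁ b₂ e : Bool) : Fin 12 → ℤ :=
  signFeatures (edgeSign (r == a₁)) (edgeSign (r == a₂)) (edgeSign (r == b₁)) (edgeSign (r == b₂))
    (edgeSign (r == e))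

/-- The dot product of integer vectors of length twelve, in a form that reduces quickly. -/
def dotTwelve (z w : Fin 12 → ℤ) : ℤ :=
  z 0 * w 0 + z 1 * w 1 + z 2 * w 2 + z 3 * w 3 + z 4 * w 4 + z 5 * w 5 + z 6 * w 6 + z 7 * w 7 +
  z 8 * w 8 + z 9 * w 9 + z 10 * w 10 + z 11 * w 11

/-- The dot product of the feature vectors of two flags with the same pair of roots. -/
def boolProduct (r a₁ a₂ b₁ b₂ e c₁ c₂ d₁ d₂ f : Bool) : ℤ :=
  dotTwelve (boolFeatures r a₁ a₂ b₁ b₂ e) (boolFeatures r c₁ c₂ d₁ d₂ f)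

/-- The sum of the products over the three ways to split four vertices into two pairs. -/
def boolMatching (r uw vw ux vx uy vy uz vz wx wy wz xy xz yz : Bool) : ℤ :=
  boolProduct r uw vw ux vx wx uy vy uz vz yz + boolProduct r uw vw uy vy wy ux vx uz vz xz +
    boolProduct r uw vw uz vz wz ux vx uy vy xy

/-- The indicator that exactly three of six Booleans are true. -/
def boolThree (a b c d e f : Bool) : ℤ :=
  cond (Nat.beq (a.toNat + b.toNat + c.toNat + d.toNat + e.toNat + f.toNat) 3) 1 0

/-- The sum of the matching products over the pairs of roots in a graph on six vertices. -/
def boolSquares (b01 b02 b03 b04 b05 b12 b13 b14 b15 b23 b24 b25 b34 b35 b45 : Bool) : ℤ :=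
  boolMatching b01 b02 b12 b03 b13 b04 b14 b05 b15 b23 b24 b25 b34 b35 b45 +
  boolMatching b02 b01 b12 b03 b23 b04 b24 b05 b25 b13 b14 b15 b34 b35 b45 +
  boolMatching b03 b01 b13 b02 b23 b04 b34 b05 b35 b12 b14 b15 b24 b25 b45 +
  boolMatching b04 b01 b14 b02 b24 b03 b34 b05 b45 b12 b13 b15 b23 b25 b35 +
  boolMatching b05 b01 b15 b02 b25 b03 b35 b04 b45 b12 b13 b14 b23 b24 b34 +
  boolMatching b12 b01 b02 b13 b23 b14 b24 b15 b25 b03 b04 b05 b34 b35 b45 +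
  boolMatching b13 b01 b03 b12 b23 b14 b34 b15 b35 b02 b04 b05 b24 b25 b45 +
  boolMatching b14 b01 b04 b12 b24 b13 b34 b15 b45 b02 b03 b05 b23 b25 b35 +
  boolMatching b15 b01 b05 b12 b25 b13 b35 b14 b45 b02 b03 b04 b23 b24 b34 +
  boolMatching b23 b02 b03 b12 b13 b24 b34 b25 b35 b01 b04 b05 b14 b15 b45 +
  boolMatching b24 b02 b04 b12 b14 b23 b34 b25 b45 b01 b03 b05 b13 b15 b35 +
  boolMatching b25 b02 b05 b12 b15 b23 b35 b24 b45 b01 b03 b04 b13 b14 b34 +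
  boolMatching b34 b03 b04 b13 b14 b23 b24 b35 b45 b01 b02 b05 b12 b15 b25 +
  boolMatching b35 b03 b05 b13 b15 b23 b25 b34 b45 b01 b02 b04 b12 b14 b24 +
  boolMatching b45 b04 b05 b14 b15 b24 b25 b34 b35 b01 b02 b03 b12 b13 b23

/-- The number of quadruples that span three edges in a graph on six vertices. -/
def boolSpan (b01 b02 b03 b04 b05 b12 b13 b14 b15 b23 b24 b25 b34 b35 b45 : Bool) : ℤ :=
  boolThree b01 b02 b03 b12 b13 b23 + boolThree b01 b02 b04 b12 b14 b24 + boolThree b01 b02 b05 b12 b15 b25 +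
  boolThree b01 b03 b04 b13 b14 b34 + boolThree b01 b03 b05 b13 b15 b35 + boolThree b01 b04 b05 b14 b15 b45 +
  boolThree b02 b03 b04 b23 b24 b34 + boolThree b02 b03 b05 b23 b25 b35 + boolThree b02 b04 b05 b24 b25 b45 +
  boolThree b03 b04 b05 b34 b35 b45 + boolThree b12 b13 b14 b23 b24 b34 + boolThree b12 b13 b15 b23 b25 b35 +
  boolThree b12 b14 b15 b24 b25 b45 + boolThree b13 b14 b15 b34 b35 b45 + boolThree b23 b24 b25 b34 b35 b45

-- Sorting the last four vertices by their adjacencies to the first two leaves 2 · 35 · 64 = 4480 of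
-- the 2^15 labelled graphs. The order hypotheses are interleaved with the quantifiers so that an
-- unsorted branch is dropped before its remaining edges are enumerated.
set_option maxRecDepth 100000 in
theorem boolSquares_add_boolSpan_le_of_sorted : ∀ b01 b02 b12 b03 b13 : Bool,
    2 * (b02).toNat + (b12).toNat ≤ 2 * (b03).toNat + (b13).toNat → ∀ b04 b14 : Bool,
    2 * (b03).toNat + (b13).toNat ≤ 2 * (b04).toNat + (b14).toNat → ∀ b05 b15 : Bool,
    2 * (b04).toNat + (b14).toNat ≤ 2 * (b05).toNat + (b15).toNat →
    ∀ b23 b24 b25 b34 b35 b45 : Bool,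
      boolSquares b01 b02 b03 b04 b05 b12 b13 b14 b15 b23
          b24 b25 b34 b35 b45 +
        5376 * boolSpan b01 b02 b03 b04 b05 b12 b13 b14 b15 b23
          b24 b25 b34 b35 b45 ≤ 40320 := by
  decide +kernel

/-! ### The squares on a graph -/

noncomputable section

variable {V : Type*}

open scoped Classical in
/-- Adjacency as a Boolean. -/
def adjBool (G : SimpleGraph V) (x y : V) : Bool := decide (G.Adj x y)

theorem adjBool_comm (G : SimpleGraph V) (x y : V) : adjBool G x y = adjBool G y x := by
  simp [adjBool, G.adj_comm]

/-- The feature vector of the flag with roots `u, v` and further vertices `x, y`. -/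
def features (G : SimpleGraph V) (u v x y : V) : Fin 12 → ℤ :=
  boolFeatures (adjBool G u v) (adjBool G u x) (adjBool G v x) (adjBool G u y) (adjBool G v y)
    (adjBool G x y)

theorem features_swap (G : SimpleGraph V) (u v x y : V) :
    features G u v y x = features G u v x y := by
  have h : ∀ r a₁ a₂ b₁ b₂ e : Bool, ∀ k,
      boolFeatures r b₁ b₂ a₁ a₂ e k = boolFeatures r a₁ a₂ b₁ b₂ e k := by decide +kernel
  funext k
  rw [features, features, adjBool_comm G y x, h]

/-- The first six functionals are built from expressions symmetric in the roots, the last six from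
antisymmetric ones. The signs cancel in products, so unordered pairs of roots suffice in
`sixSquares`. -/
theorem features_swap_roots (G : SimpleGraph V) (u v x y : V) (k : Fin 12) :
    features G v u x y k = (if k < 6 then 1 else -1) * features G u v x y k := by
  have h : ∀ r a₁ a₂ b₁ b₂ e : Bool, ∀ k : Fin 12, boolFeatures r a₂ a₁ b₂ b₁ e k =
      (if k < 6 then 1 else -1) * boolFeatures r a₁ a₂ b₁ b₂ e k := by decide +kernel
  rw [features, features, adjBool_comm G v u, h]

/-- The dot product of the feature vectors of two flags with the roots `u, v`. -/
def flagProduct (G : SimpleGraph V) (u v x y x' y' : V) : ℤ :=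
  ∑ k, features G u v x y k * features G u v x' y' k

theorem flagProduct_eq_boolProduct (G : SimpleGraph V) (u v x y x' y' : V) :
    flagProduct G u v x y x' y' =
      boolProduct (adjBool G u v) (adjBool G u x) (adjBool G v x) (adjBool G u y) (adjBool G v y)
        (adjBool G x y) (adjBool G u x') (adjBool G v x') (adjBool G u y') (adjBool G v y')
        (adjBool G x' y') := by
  rw [flagProduct, boolProduct, dotTwelve]
  simp only [Fin.sum_univ_succ, Finset.univ_unique, Finset.sum_singleton, ← add_assoc]
  rfl

theorem flagProduct_swap_roots (G : SimpleGraph V) (u v x y x' y' : V) :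
    flagProduct G v u x y x' y' = flagProduct G u v x y x' y' := by
  refine Finset.sum_congr rfl fun k _ => ?_
  rw [features_swap_roots, features_swap_roots G u v x' y']
  split_ifs <;> ring

theorem flagProduct_swap_left (G : SimpleGraph V) (u v x y x' y' : V) :
    flagProduct G u v y x x' y' = flagProduct G u v x y x' y' := by
  simp only [flagProduct, features_swap G u v x y]

theorem flagProduct_swap_right (G : SimpleGraph V) (u v x y x' y' : V) :
    flagProduct G u v x y y' x' = flagProduct G u v x y x' y' := by
  simp only [flagProduct, features_swap G u v x' y']

theorem flagProduct_comm (G : SimpleGraph V) (u v x y x' y' : V) :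
    flagProduct G u v x' y' x y = flagProduct G u v x y x' y' := by
  simp only [flagProduct, mul_comm]

/-- The sum of the products over the three ways to split four vertices into two pairs. -/
def matchingProduct (G : SimpleGraph V) (u v w x y z : V) : ℤ :=
  flagProduct G u v w x y z + flagProduct G u v w y x z + flagProduct G u v w z x y

theorem matchingProduct_swap_roots (G : SimpleGraph V) (u v w x y z : V) :
    matchingProduct G v u w x y z = matchingProduct G u v w x y z := by
  simp only [matchingProduct, flagProduct_swap_roots G u v]

theorem matchingProduct_swap_first (G : SimpleGraph V) (u v w x y z : V) :
    matchingProduct G u v x w y z = matchingProduct G u v w x y z := by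
  rw [matchingProduct, matchingProduct, flagProduct_swap_left G u v w x,
    flagProduct_comm G u v w z, flagProduct_comm G u v w y]
  ring

theorem matchingProduct_swap_middle (G : SimpleGraph V) (u v w x y z : V) :
    matchingProduct G u v w y x z = matchingProduct G u v w x y z := by
  rw [matchingProduct, matchingProduct, flagProduct_swap_right G u v w z x y]
  ring

theorem matchingProduct_swap_last (G : SimpleGraph V) (u v w x y z : V) :
    matchingProduct G u v w x z y = matchingProduct G u v w x y z := by
  rw [matchingProduct, matchingProduct, flagProduct_swap_right G u v w x y z]
  ring

/-- The indicator that four vertices span exactly three edges. -/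
def spanThree (G : SimpleGraph V) (a b c d : V) : ℤ :=
  boolThree (adjBool G a b) (adjBool G a c) (adjBool G a d) (adjBool G b c) (adjBool G b d)
    (adjBool G c d)

theorem spanThree_swap_first (G : SimpleGraph V) (a b c d : V) :
    spanThree G b a c d = spanThree G a b c d := by
  have h : ∀ p q r s t u : Bool, boolThree p s t q r u = boolThree p q r s t u := by decide
  rw [spanThree, spanThree, adjBool_comm G b a, h]

theorem spanThree_swap_middle (G : SimpleGraph V) (a b c d : V) :
    spanThree G a c b d = spanThree G a b c d := by
  have h : ∀ p q r s t u : Bool, boolThree q p r s u t = boolThree p q r s t u := by decide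
  rw [spanThree, spanThree, adjBool_comm G c b, h]

theorem spanThree_swap_last (G : SimpleGraph V) (a b c d : V) :
    spanThree G a b d c = spanThree G a b c d := by
  have h : ∀ p q r s t u : Bool, boolThree p r q t s u = boolThree p q r s t u := by decide
  rw [spanThree, spanThree, adjBool_comm G d c, h]

/-- The sum of the matching products over the pairs of roots among six vertices. -/
def sixSquares (G : SimpleGraph V) (a b c d e f : V) : ℤ :=
  matchingProduct G a b c d e f + matchingProduct G a c b d e f + matchingProduct G a d b c e f +
  matchingProduct G a e b c d f + matchingProduct G a f b c d e + matchingProduct G b c a d e f +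
  matchingProduct G b d a c e f + matchingProduct G b e a c d f + matchingProduct G b f a c d e +
  matchingProduct G c d a b e f + matchingProduct G c e a b d f + matchingProduct G c f a b d e +
  matchingProduct G d e a b c f + matchingProduct G d f a b c e + matchingProduct G e f a b c d

/-- The number of quadruples among six vertices that span exactly three edges. -/
def sixSpan (G : SimpleGraph V) (a b c d e f : V) : ℤ :=
  spanThree G a b c d + spanThree G a b c e + spanThree G a b c f +
  spanThree G a b d e + spanThree G a b d f + spanThree G a b e f +
  spanThree G a c d e + spanThree G a c d f + spanThree G a c e f +
  spanThree G a d e f + spanThree G b c d e + spanThree G b c d f +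
  spanThree G b c e f + spanThree G b d e f + spanThree G c d e f

theorem sixSquares_swaps (G : SimpleGraph V) (a b c d e f : V) :
    sixSquares G b a c d e f = sixSquares G a b c d e f ∧
    sixSquares G a c b d e f = sixSquares G a b c d e f ∧
    sixSquares G a b d c e f = sixSquares G a b c d e f ∧
    sixSquares G a b c e d f = sixSquares G a b c d e f ∧
    sixSquares G a b c d f e = sixSquares G a b c d e f := by
  refine ⟨?_, ?_, ?_, ?_, ?_⟩ <;>
  · simp only [sixSquares, matchingProduct_swap_roots, matchingProduct_swap_first,
      matchingProduct_swap_middle, matchingProduct_swap_last]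
    ring

theorem sixSpan_swaps (G : SimpleGraph V) (a b c d e f : V) :
    sixSpan G b a c d e f = sixSpan G a b c d e f ∧
    sixSpan G a c b d e f = sixSpan G a b c d e f ∧
    sixSpan G a b d c e f = sixSpan G a b c d e f ∧
    sixSpan G a b c e d f = sixSpan G a b c d e f ∧
    sixSpan G a b c d f e = sixSpan G a b c d e f := by
  refine ⟨?_, ?_, ?_, ?_, ?_⟩ <;>
  · simp only [sixSpan, spanThree_swap_first, spanThree_swap_middle, spanThree_swap_last]
    ring

/-- Adjacent transpositions generate the symmetric group, so invariance needs to be checked on five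
swaps only. -/
theorem comp_perm_of_swaps {α : Type*} {Q : V → V → V → V → V → V → α}
    (hQ : ∀ a b c d e f, Q b a c d e f = Q a b c d e f ∧ Q a c b d e f = Q a b c d e f ∧
      Q a b d c e f = Q a b c d e f ∧ Q a b c e d f = Q a b c d e f ∧
      Q a b c d f e = Q a b c d e f) (σ : Equiv.Perm (Fin 6)) (g : Fin 6 → V) :
    Q (g (σ 0)) (g (σ 1)) (g (σ 2)) (g (σ 3)) (g (σ 4)) (g (σ 5)) =
      Q (g 0) (g 1) (g 2) (g 3) (g 4) (g 5) := by
  have hσ : σ ∈ Submonoid.closure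
      (Set.range fun i : Fin 5 => Equiv.swap i.castSucc i.succ) := by
    rw [Equiv.Perm.mclosure_swap_castSucc_succ]; trivial
  induction hσ using Submonoid.closure_induction generalizing g with
  | one => rfl
  | mul σ τ _ _ hs ht => exact (ht (g ∘ σ)).trans (hs g)
  | mem σ hσ =>
    obtain ⟨i, rfl⟩ := hσ
    obtain ⟨h1, h2, h3, h4, h5⟩ := hQ (g 0) (g 1) (g 2) (g 3) (g 4) (g 5)
    fin_cases i
    · exact h1
    · exact h2
    · exact h3
    · exact h4
    · exact h5

/-- Both quantities are permutation invariant, so the vertices may be sorted. Injectivity of `g`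
plays no role, since the finite inequality holds for arbitrary edge values; this permits summation
over all tuples later. -/
theorem sixSquares_add_sixSpan_le (G : SimpleGraph V) (g : Fin 6 → V) :
    sixSquares G (g 0) (g 1) (g 2) (g 3) (g 4) (g 5) +
      5376 * sixSpan G (g 0) (g 1) (g 2) (g 3) (g 4) (g 5) ≤ 40320 := by
  -- The keys 0 and 1 pin the first two vertices; all other keys are at least 2 and encode the
  -- adjacencies to these two.
  let key : Fin 6 → ℕ := fun i => if i = 0 then 0 else if i = 1 then 1 else
    2 + (2 * (adjBool G (g 0) (g i)).toNat + (adjBool G (g 1) (g i)).toNat)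
  have hkey : Monotone (key ∘ Tuple.sort key) := Tuple.monotone_sort key
  set σ := Tuple.sort key with hσ
  have h0 : σ 0 = 0 := by
    have h := hkey (Fin.zero_le (σ.symm 0))
    simp only [Function.comp_apply, Equiv.apply_symm_apply] at h
    by_contra hne
    simp only [key, if_neg hne, if_true] at h
    split_ifs at h <;> omega
  have h1 : σ 1 = 1 := by
    have hne0 : σ 1 ≠ 0 := fun h => by simpa using σ.injective (h.trans h0.symm)
    have hle : (1 : Fin 6) ≤ σ.symm 1 := by
      refine Fin.one_le_of_ne_zero fun h => ?_
      have := σ.apply_symm_apply 1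
      rw [h, h0] at this
      simp at this
    have h := hkey hle
    simp only [Function.comp_apply, Equiv.apply_symm_apply] at h
    by_contra hne
    simp only [key, if_neg hne, if_neg hne0, if_true] at h
    simp at h
    omega
  have hge : ∀ i : Fin 6, i ≠ 0 → i ≠ 1 → key (σ i) = 2 +
      (2 * (adjBool G (g (σ 0)) (g (σ i))).toNat + (adjBool G (g (σ 1)) (g (σ i))).toNat) := by
    intro i hi hi'
    have h2 : σ i ≠ 0 := fun h => hi (σ.injective (h.trans h0.symm))
    have h3 : σ i ≠ 1 := fun h => hi' (σ.injective (h.trans h1.symm))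
    simp only [key, if_neg h2, if_neg h3, h0, h1]
  have hsort : ∀ i j : Fin 6, i ≠ 0 → i ≠ 1 → i ≤ j →
      2 * (adjBool G (g (σ 0)) (g (σ i))).toNat + (adjBool G (g (σ 1)) (g (σ i))).toNat ≤
      2 * (adjBool G (g (σ 0)) (g (σ j))).toNat + (adjBool G (g (σ 1)) (g (σ j))).toNat := by
    intro i j hi hi' hij
    have h := hkey hij
    simp only [Function.comp_apply] at h
    rw [hge i hi hi', hge j (by omega) (by omega)] at h
    omega
  rw [← comp_perm_of_swaps (sixSquares_swaps G) σ, ← comp_perm_of_swaps (sixSpan_swaps G) σ]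
  have h := boolSquares_add_boolSpan_le_of_sorted (adjBool G (g (σ 0)) (g (σ 1))) _ _ _ _
    (hsort 2 3 (by decide) (by decide) (by decide)) _ _
    (hsort 3 4 (by decide) (by decide) (by decide)) _ _
    (hsort 4 5 (by decide) (by decide) (by decide))
    (adjBool G (g (σ 2)) (g (σ 3))) (adjBool G (g (σ 2)) (g (σ 4))) (adjBool G (g (σ 2)) (g (σ 5)))
    (adjBool G (g (σ 3)) (g (σ 4))) (adjBool G (g (σ 3)) (g (σ 5))) (adjBool G (g (σ 4)) (g (σ 5)))
  refine le_trans (le_of_eq ?_) h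
  generalize g (σ 0) = a, g (σ 1) = b, g (σ 2) = c, g (σ 3) = d, g (σ 4) = e, g (σ 5) = f
  simp only [sixSquares, matchingProduct, flagProduct_eq_boolProduct, boolSquares, boolMatching,
    sixSpan, spanThree, boolSpan, adjBool_comm G b a, adjBool_comm G c a, adjBool_comm G c b,
    adjBool_comm G d a, adjBool_comm G d b, adjBool_comm G d c, adjBool_comm G e a,
    adjBool_comm G e b, adjBool_comm G e c, adjBool_comm G e d, adjBool_comm G f a,
    adjBool_comm G f b, adjBool_comm G f c, adjBool_comm G f d, adjBool_comm G f e]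

/-! ### Sums over tuples, injections and subsets -/

open scoped Classical in
theorem sum_embedding_eq_sum_ite {V : Type*} [Fintype V] {k : ℕ} (h : (Fin k → V) → ℝ) :
    ∑ g : Fin k ↪ V, h g = ∑ g : Fin k → V, if Function.Injective g then h g else 0 := by
  rw [← Finset.sum_filter, ← Finset.sum_subtype_eq_sum_filter, Finset.subtype_univ]
  exact Fintype.sum_equiv (Equiv.subtypeInjectiveEquivEmbedding (Fin k) V).symm _ _ fun _ => rfl

theorem sum_tuple_succ {V : Type*} [Fintype V] {k : ℕ} (h : (Fin (k + 1) → V) → ℝ) :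
    ∑ g : Fin (k + 1) → V, h g = ∑ a : V, ∑ g : Fin k → V, h (Fin.cons a g) := by
  rw [← Fintype.sum_prod_type' (fun a g => h (Fin.cons a g))]
  exact (Fintype.sum_equiv (Fin.consEquiv fun _ => V) _ _ fun _ => rfl).symm

/-- One more factor n - (k+1) in place of n costs at most (k+1) n^(k+1), and (k+1)² + (k+1) ≤
(k+2)². -/
theorem pow_sub_descFactorial_le (n k : ℕ) :
    (n : ℝ) ^ (k + 1) - (n.descFactorial (k + 1) : ℝ) ≤ (k + 1) ^ 2 * (n : ℝ) ^ k := by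
  induction k with
  | zero => simp
  | succ k ih =>
    have hn : (0 : ℝ) ≤ n := n.cast_nonneg
    have h1 : (n.descFactorial (k + 1) : ℝ) ≤ (n : ℝ) ^ (k + 1) := by
      exact_mod_cast n.descFactorial_le_pow (k + 1)
    have h2 : ((n : ℝ) - (k + 1)) * (n.descFactorial (k + 1) : ℝ) ≤
        (n.descFactorial (k + 1 + 1) : ℝ) := by
      rw [Nat.descFactorial_succ n (k + 1), Nat.cast_mul]
      refine mul_le_mul_of_nonneg_right ?_ (Nat.cast_nonneg _)
      -- Truncated subtraction is at least the real difference, so small `n` needs no separate case.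
      rw [sub_le_iff_le_add]
      exact_mod_cast (by omega : n ≤ n - (k + 1) + (k + 1))
    have h3 := mul_le_mul_of_nonneg_left ih hn
    have h4 : (0 : ℝ) ≤ (n : ℝ) ^ (k + 1) := pow_nonneg hn _
    have h5 := mul_le_mul_of_nonneg_left h1 (by positivity : (0 : ℝ) ≤ (k : ℝ) + 1)
    push_cast
    have e1 : (n : ℝ) ^ (k + 1 + 1) = n * (n : ℝ) ^ (k + 1) := by ring
    have e2 : (n : ℝ) * ((k + 1) ^ 2 * (n : ℝ) ^ k) = (k + 1) ^ 2 * (n : ℝ) ^ (k + 1) := by ring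
    have h6 := mul_nonneg (k.cast_nonneg : (0 : ℝ) ≤ k) h4
    nlinarith

open scoped Classical in
theorem sum_ite_not_injective_le {V : Type*} [Fintype V] (k : ℕ) :
    ∑ g : Fin (k + 1) → V, (if Function.Injective g then (0 : ℝ) else 1) ≤
      (k + 1) ^ 2 * (Fintype.card V : ℝ) ^ k := by
  have h1 := sum_embedding_eq_sum_ite (V := V) (k := k + 1) fun _ => (1 : ℝ)
  have h2 : ∑ g : Fin (k + 1) → V, (if Function.Injective g then (0 : ℝ) else 1) =
      ∑ g : Fin (k + 1) → V, (1 - if Function.Injective g then (1 : ℝ) else 0) :=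
    Finset.sum_congr rfl fun g _ => by split_ifs <;> simp
  rw [h2, Finset.sum_sub_distrib, ← h1]
  have h3 := pow_sub_descFactorial_le (Fintype.card V) k
  simpa [Fintype.card_embedding_eq] using h3

open scoped Classical in
/-- Sums of a function with values in `[-M, M]` over all tuples that satisfy a condition weaker
than injectivity, and over all injections, differ by at most `O(n^k)`. -/
theorem abs_sum_ite_sub_sum_embedding_le {V : Type*} [Fintype V] {k : ℕ}
    (P : (Fin (k + 1) → V) → Prop) (hP : ∀ g, Function.Injective g → P g)
    (h : (Fin (k + 1) → V) → ℝ) {M : ℝ} (hM0 : 0 ≤ M) (hM : ∀ g, |h g| ≤ M) :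
    |(∑ g : Fin (k + 1) → V, if P g then h g else 0) - ∑ g : Fin (k + 1) ↪ V, h g| ≤
      M * ((k + 1) ^ 2 * (Fintype.card V : ℝ) ^ k) := by
  rw [sum_embedding_eq_sum_ite, ← Finset.sum_sub_distrib]
  refine (Finset.abs_sum_le_sum_abs _ _).trans ?_
  refine le_trans ?_ (mul_le_mul_of_nonneg_left (sum_ite_not_injective_le (V := V) k) hM0)
  rw [Finset.mul_sum]
  refine Finset.sum_le_sum fun g _ => ?_
  by_cases hg : Function.Injective g
  · simp [hg, hP g hg]
  · by_cases hp : P g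
    · simpa [hg, hp] using hM g
    · simpa [hg, hp] using hM0

open scoped Classical in
theorem card_filter_map_eq {V : Type*} [Fintype V] {k : ℕ} {S : Finset V} (hS : S.card = k) :
    (Finset.univ.filter fun g : Fin k ↪ V => Finset.univ.map g = S).card = k.factorial := by
  have e : {g : Fin k ↪ V // Finset.univ.map g = S} ≃ (Fin k ↪ S) :=
    { toFun := fun g => Function.Embedding.codRestrict (S : Set V) g.1 fun i => by
        have h : g.1 i ∈ Finset.univ.map g.1 := by simp
        rwa [g.2] at h
      invFun := fun g => ⟨g.trans (Function.Embedding.subtype _), by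
        refine Finset.eq_of_subset_of_card_le (fun x hx => ?_) (by simp [hS])
        simp only [Finset.mem_map, Finset.mem_univ, true_and] at hx
        obtain ⟨i, rfl⟩ := hx
        exact (g i).2⟩
      left_inv := fun g => rfl
      right_inv := fun g => rfl }
  rw [← Fintype.card_subtype, Fintype.card_congr e, Fintype.card_embedding_eq]
  simp [hS, Nat.descFactorial_self]

open scoped Classical in
theorem sum_embedding_map {V : Type*} [Fintype V] {k : ℕ} (h : Finset V → ℝ) :
    ∑ g : Fin k ↪ V, h (Finset.univ.map g) =
      k.factorial * ∑ S ∈ Finset.univ.powersetCard k, h S := by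
  rw [← Finset.sum_fiberwise_of_maps_to (s := Finset.univ)
    (t := (Finset.univ : Finset V).powersetCard k) (g := fun g : Fin k ↪ V => Finset.univ.map g)
    (fun g _ => by simp [Finset.mem_powersetCard]), Finset.mul_sum]
  refine Finset.sum_congr rfl fun S hS => ?_
  rw [Finset.sum_congr rfl fun g hg => by rw [(Finset.mem_filter.mp hg).2], Finset.sum_const,
    card_filter_map_eq (Finset.mem_powersetCard.mp hS).2, nsmul_eq_mul]

/-! ### Counting induced subgraphs and spanned edges by injections -/

/-- The graph pulled back along an injection is the graph induced on its image. -/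
def comapIsoInduce {V : Type*} (G : SimpleGraph V) {k : ℕ} (g : Fin k ↪ V) :
    G.comap g ≃g G.induce ((Finset.univ.map g : Finset V) : Set V) where
  toEquiv := (Equiv.ofInjective g g.injective).trans (Equiv.setCongr (by simp))
  map_rel_iff' := Iff.rfl

open scoped Classical in
theorem factorial_mul_inducedCount {V : Type*} [Fintype V] {k : ℕ} (F : SimpleGraph (Fin k))
    (G : SimpleGraph V) :
    (k.factorial : ℝ) * inducedCount F G =
      ∑ g : Fin k ↪ V, if Nonempty (F ≃g G.comap g) then 1 else 0 := by
  rw [inducedCount, Finset.card_filter, Nat.cast_sum, ← sum_embedding_map]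
  refine Finset.sum_congr rfl fun g _ => ?_
  have : Nonempty (F ≃g G.induce ((Finset.univ.map g : Finset V) : Set V)) ↔
      Nonempty (F ≃g G.comap g) :=
    ⟨fun ⟨e⟩ => ⟨e.trans (comapIsoInduce G g).symm⟩, fun ⟨e⟩ => ⟨e.trans (comapIsoInduce G g)⟩⟩
  simp only [this]
  split_ifs <;> simp

-- Each injection pulls `G` back to exactly one isomorphism class, so class-weighted subgraph counts
-- become sums over injections.
open scoped Classical in
theorem factorial_mul_sum_inducedCount {V : Type*} [Fintype V] {k : ℕ} (c : GraphClass k → ℝ)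
    (G : SimpleGraph V) :
    (k.factorial : ℝ) * ∑ F : GraphClass k, c F * (inducedCount F.out G : ℝ) =
      ∑ g : Fin k ↪ V, c (Quotient.mk (isoSetoid k) (G.comap g)) := by
  have h : ∀ F : GraphClass k, (k.factorial : ℝ) * (c F * (inducedCount F.out G : ℝ)) =
      ∑ g : Fin k ↪ V, if Quotient.mk (isoSetoid k) (G.comap g) = F then c F else 0 := by
    intro F
    rw [mul_left_comm, factorial_mul_inducedCount, Finset.mul_sum]
    refine Finset.sum_congr rfl fun g _ => ?_
    have : Nonempty (F.out ≃g G.comap g) ↔ Quotient.mk (isoSetoid k) (G.comap g) = F :=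
      ⟨fun h => (Quotient.sound (s := isoSetoid k) h).symm.trans F.out_eq,
        fun h => Quotient.exact (s := isoSetoid k) (F.out_eq.trans h.symm)⟩
    simp only [this]
    split_ifs <;> simp
  rw [Finset.mul_sum, Finset.sum_congr rfl fun F _ => h F, Finset.sum_comm]
  exact Finset.sum_congr rfl fun g _ => by simp

theorem ncard_edgeSet_eq_of_iso {V W : Type*} {G : SimpleGraph V} {H : SimpleGraph W}
    (e : G ≃g H) : G.edgeSet.ncard = H.edgeSet.ncard :=
  Nat.card_congr e.mapEdgeSet

theorem ncard_edgeSet_fin_four (H : SimpleGraph (Fin 4)) :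
    H.edgeSet.ncard = (adjBool H 0 1).toNat + (adjBool H 0 2).toNat + (adjBool H 0 3).toNat +
      (adjBool H 1 2).toNat + (adjBool H 1 3).toNat + (adjBool H 2 3).toNat := by
  classical
  -- In the handshake identity each of the six pairs occurs in two degrees.
  have h := H.sum_degrees_eq_twice_card_edges
  have hd : ∀ v, H.degree v = ∑ w, (adjBool H v w).toNat := by
    intro v
    rw [← H.card_neighborFinset_eq_degree, H.neighborFinset_eq_filter, Finset.card_filter]
    refine Finset.sum_congr rfl fun w _ => ?_
    by_cases hw : H.Adj v w <;> simp [adjBool, hw]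
  have hs : ∀ v, adjBool H v v = false := fun v => by simp [adjBool]
  simp only [hd, Fin.sum_univ_four, hs, adjBool_comm H 1 0, adjBool_comm H 2 0,
    adjBool_comm H 3 0, adjBool_comm H 2 1, adjBool_comm H 3 1, adjBool_comm H 3 2] at h
  rw [Set.ncard_eq_toFinset_card', ← SimpleGraph.edgeFinset]
  simp only [Bool.toNat_false] at h
  omega

theorem boolThree_eq_ite (a b c d e f : Bool) : boolThree a b c d e f =
    if a.toNat + b.toNat + c.toNat + d.toNat + e.toNat + f.toNat = 3 then 1 else 0 := by
  revert a b c d e f; decide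

open scoped Classical in
theorem ite_ncard_induce_map {V : Type*} (G : SimpleGraph V) (g : Fin 4 ↪ V) :
    (if (G.induce ((Finset.univ.map g : Finset V) : Set V)).edgeSet.ncard = 3 then (1 : ℤ)
      else 0) = spanThree G (g 0) (g 1) (g 2) (g 3) := by
  rw [← ncard_edgeSet_eq_of_iso (comapIsoInduce G g), ncard_edgeSet_fin_four, spanThree,
    boolThree_eq_ite]
  rfl

theorem factorial_mul_spanCount {V : Type*} [Fintype V] (G : SimpleGraph V) :
    24 * (spanCount 4 3 G : ℝ) = ∑ g : Fin 4 ↪ V, (spanThree G (g 0) (g 1) (g 2) (g 3) : ℝ) := by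
  classical
  rw [spanCount, Finset.card_filter, Nat.cast_sum,
    show (24 : ℝ) = ((4 : ℕ).factorial : ℝ) by norm_num [Nat.factorial], ← sum_embedding_map]
  refine Finset.sum_congr rfl fun g _ => ?_
  rw [← ite_ncard_induce_map]
  split_ifs <;> simp

theorem spanCount_fin_six (F : SimpleGraph (Fin 6)) :
    (spanCount 4 3 F : ℤ) = sixSpan F 0 1 2 3 4 5 := by
  classical
  have h4 : ∀ g : Fin 4 → Fin 6, Function.Injective g → ∀ S : Finset (Fin 6),
      S = Finset.univ.image g → (if (F.induce (S : Set (Fin 6))).edgeSet.ncard = 3 then (1 : ℤ)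
        else 0) = spanThree F (g 0) (g 1) (g 2) (g 3) := by
    intro g hg S hS
    have h := ite_ncard_induce_map F ⟨g, hg⟩
    rw [Finset.map_eq_image] at h
    rw [hS]
    exact h
  have hp : (Finset.univ : Finset (Fin 6)).powersetCard 4 =
      {{0, 1, 2, 3}, {0, 1, 2, 4}, {0, 1, 2, 5}, {0, 1, 3, 4}, {0, 1, 3, 5}, {0, 1, 4, 5},
        {0, 2, 3, 4}, {0, 2, 3, 5}, {0, 2, 4, 5}, {0, 3, 4, 5}, {1, 2, 3, 4}, {1, 2, 3, 5},
        {1, 2, 4, 5}, {1, 3, 4, 5}, {2, 3, 4, 5}} := by decide +kernel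
  rw [spanCount, Finset.card_filter, Nat.cast_sum]
  simp only [Nat.cast_ite, Nat.cast_one, Nat.cast_zero]
  rw [hp]
  repeat rw [Finset.sum_insert (by decide +kernel)]
  rw [Finset.sum_singleton]
  rw [h4 ![0, 1, 2, 3] (by decide) _ (by decide), h4 ![0, 1, 2, 4] (by decide) _ (by decide),
    h4 ![0, 1, 2, 5] (by decide) _ (by decide), h4 ![0, 1, 3, 4] (by decide) _ (by decide),
    h4 ![0, 1, 3, 5] (by decide) _ (by decide), h4 ![0, 1, 4, 5] (by decide) _ (by decide),
    h4 ![0, 2, 3, 4] (by decide) _ (by decide), h4 ![0, 2, 3, 5] (by decide) _ (by decide),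
    h4 ![0, 2, 4, 5] (by decide) _ (by decide), h4 ![0, 3, 4, 5] (by decide) _ (by decide),
    h4 ![1, 2, 3, 4] (by decide) _ (by decide), h4 ![1, 2, 3, 5] (by decide) _ (by decide),
    h4 ![1, 2, 4, 5] (by decide) _ (by decide), h4 ![1, 3, 4, 5] (by decide) _ (by decide),
    h4 ![2, 3, 4, 5] (by decide) _ (by decide)]
  simp only [sixSpan, ← add_assoc]
  rfl

/-! ### Linear functionals of flag vectors -/

open scoped Classical in
/-- The `k`-th feature, summed over the ordered pairs of non-roots of a flag with two roots. -/
def flagFunctional {V : Type*} [Fintype V] {τ : SimpleGraph (Fin 2)} (k : Fin 12)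
    (H : TFlag τ V) : ℝ :=
  ∑ x : V, ∑ y : V, if x ≠ y ∧ (∀ i, x ≠ H.root i) ∧ (∀ i, y ≠ H.root i) then
    (features H.graph (H.root 0) (H.root 1) x y k : ℝ) else 0

theorem adjBool_iso {V W : Type*} {G : SimpleGraph V} {H : SimpleGraph W} (e : G ≃g H) (x y : V) :
    adjBool H (e x) (e y) = adjBool G x y := by
  simp [adjBool, e.map_adj_iff]

theorem flagFunctional_eq_of_iso {V W : Type*} [Fintype V] [Fintype W] {τ : SimpleGraph (Fin 2)}
    {F : TFlag τ V} {H : TFlag τ W} (e : F.graph ≃g H.graph) (he : ∀ i, e (F.root i) = H.root i)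
    (k : Fin 12) : flagFunctional k F = flagFunctional k H := by
  refine Fintype.sum_equiv e.toEquiv _ _ fun x => Fintype.sum_equiv e.toEquiv _ _ fun y => ?_
  have h : ∀ x : V, (∀ i, e x ≠ H.root i) ↔ ∀ i, x ≠ F.root i := fun x =>
    forall_congr' fun i => by rw [← he i]; exact e.injective.ne_iff
  simp only [features, RelIso.coe_fn_toEquiv]
  rw [← he 0, ← he 1]
  simp only [adjBool_iso]
  classical
  exact if_congr (and_congr e.injective.ne_iff.symm (and_congr (h x).symm (h y).symm)) rfl rfl

section Extension

variable {V : Type*} {τ : SimpleGraph (Fin 2)} (H : TFlag τ V) (h : Fin 2 ↪ V)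

/-- The roots of a flag followed by two further vertices. -/
def extendRoots : Fin 4 → V := ![H.root 0, H.root 1, h 0, h 1]

variable {H h}

theorem extendRoots_injective (hd : ∀ i j, h i ≠ H.root j) :
    Function.Injective (extendRoots H h) := by
  have h1 : H.root 0 ≠ H.root 1 := H.root.injective.ne (by decide)
  have h2 : h 0 ≠ h 1 := h.injective.ne (by decide)
  intro i j hij
  fin_cases i <;> fin_cases j <;>
    simp_all [extendRoots, fun i j => (hd i j).symm, h1.symm, h2.symm]

variable (H h)

/-- The subflag on the roots of a flag and two further vertices. -/
def pairFlag : TFlag τ (Fin 4) where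
  graph := H.graph.comap (extendRoots H h)
  root :=
    { toFun := Fin.castLE (by decide)
      inj' := Fin.castLE_injective _
      map_rel_iff' := by
        intro a b
        rw [← H.root.map_adj_iff]
        fin_cases a <;> fin_cases b <;> rfl }

variable {H h}

/-- `pairFlag` is a concrete copy of the subflag on the roots and the image of `h`, so counting
subflags of a class amounts to reading off the class of `pairFlag`. -/
theorem exists_iso_iff [Fintype V] (hd : ∀ i j, h i ≠ H.root j) (F : FlagClass τ 4) :
    (∃ e : F.out.graph ≃g
        H.graph.induce (((Finset.univ.map h : Finset V) : Set V) ∪ Set.range H.root),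
      ∀ i, (e (F.out.root i) : V) = H.root i) ↔
    Quotient.mk (TFlag.setoid τ 4) (pairFlag H h) = F := by
  have hr : Set.range (extendRoots H h) =
      ((Finset.univ.map h : Finset V) : Set V) ∪ Set.range H.root := by
    ext x
    simp only [extendRoots, Set.mem_range, Fin.exists_fin_succ, Set.mem_union, Finset.mem_coe,
      Finset.mem_map, Finset.mem_univ, true_and]
    simp
    tauto
  let κ : (pairFlag H h).graph ≃g
      H.graph.induce (((Finset.univ.map h : Finset V) : Set V) ∪ Set.range H.root) :=
    { toEquiv := (Equiv.ofInjective _ (extendRoots_injective hd)).trans (Equiv.setCongr hr)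
      map_rel_iff' := Iff.rfl }
  have hκ : ∀ i, (κ ((pairFlag H h).root i) : V) = H.root i := by
    intro i
    fin_cases i <;> rfl
  constructor
  · rintro ⟨e, he⟩
    rw [← F.out_eq]
    refine (Quotient.sound (s := TFlag.setoid τ 4) ⟨e.trans κ.symm, fun i => ?_⟩).symm
    have : e (F.out.root i) = κ ((pairFlag H h).root i) :=
      Subtype.ext ((he i).trans (hκ i).symm)
    rw [RelIso.trans_apply, this, RelIso.symm_apply_apply]
  · intro hF
    obtain ⟨e, he⟩ := Quotient.exact (s := TFlag.setoid τ 4) (F.out_eq.trans hF.symm)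
    exact ⟨e.trans κ, fun i => by rw [RelIso.trans_apply, he i, hκ i]⟩

/-- The roots occupy 0 and 1, so only the ordered pairs (2,3) and (3,2) contribute, and they
contribute equally. -/
theorem flagFunctional_pairFlag (k : Fin 12) : flagFunctional k (pairFlag H h) =
    2 * (features H.graph (H.root 0) (H.root 1) (h 0) (h 1) k : ℝ) := by
  have h0 : (pairFlag H h).root 0 = 0 := rfl
  have h1 : (pairFlag H h).root 1 = 1 := rfl
  have hf : ∀ x y, features (pairFlag H h).graph 0 1 x y k =
    features H.graph (H.root 0) (H.root 1) (extendRoots H h x) (extendRoots H h y) k :=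
    fun x y => rfl
  have e2 : extendRoots H h 2 = h 0 := rfl
  have e3 : extendRoots H h 3 = h 1 := rfl
  simp only [flagFunctional, Fin.forall_fin_two, h0, h1, Fin.sum_univ_four, hf, e2, e3]
  simp [features_swap H.graph _ _ (h 0) (h 1)]
  ring

end Extension

-- The functional of a large flag splits over its pairs of non-roots, and each share depends only on
-- the class of the four-vertex subflag. It is therefore exactly linear in the flag vector, which
-- lets its square be written with a rank-one matrix.
open scoped Classical in
theorem sum_flagFunctional_mul_flagCount {V : Type*} [Fintype V] {τ : SimpleGraph (Fin 2)}
    (H : TFlag τ V) (k : Fin 12) :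
    ∑ F : FlagClass τ 4, flagFunctional k F.out * (flagCount F.out H : ℝ) =
      flagFunctional k H := by
  have hdis : ∀ h : Fin 2 ↪ V, Disjoint ((Finset.univ.map h : Finset V) : Set V)
      (Set.range H.root) ↔ ∀ i j, h i ≠ H.root j := by
    intro h
    rw [Set.disjoint_left]
    simp [eq_comm]
  have hcount : ∀ F : FlagClass τ 4, 2 * (flagCount F.out H : ℝ) =
      ∑ h : Fin 2 ↪ V, if (∀ i j, h i ≠ H.root j) ∧
        Quotient.mk (TFlag.setoid τ 4) (pairFlag H h) = F then 1 else 0 := by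
    intro F
    rw [flagCount, Finset.card_filter, Nat.cast_sum,
      show (2 : ℝ) = ((2 : ℕ).factorial : ℝ) by norm_num, ← sum_embedding_map]
    refine Finset.sum_congr rfl fun h _ => ?_
    by_cases hd : ∀ i j, h i ≠ H.root j
    · simp only [hdis, exists_iso_iff hd]
      split_ifs <;> simp
    · simp only [hdis, hd, false_and, if_false, Nat.cast_zero]
  have hsum : 2 * ∑ F : FlagClass τ 4, flagFunctional k F.out * (flagCount F.out H : ℝ) =
      ∑ h : Fin 2 ↪ V, if ∀ i j, h i ≠ H.root j then
        2 * (features H.graph (H.root 0) (H.root 1) (h 0) (h 1) k : ℝ) else 0 := by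
    rw [Finset.mul_sum]
    simp only [mul_left_comm (2 : ℝ), hcount, Finset.mul_sum]
    rw [Finset.sum_comm]
    refine Finset.sum_congr rfl fun h _ => ?_
    by_cases hd : ∀ i j, h i ≠ H.root j
    · rw [if_pos hd, ← flagFunctional_pairFlag]
      have he : flagFunctional k (Quotient.mk (TFlag.setoid τ 4) (pairFlag H h)).out =
          flagFunctional k (pairFlag H h) := by
        obtain ⟨e, he⟩ := Quotient.exact (s := TFlag.setoid τ 4)
          (Quotient.out_eq (Quotient.mk (TFlag.setoid τ 4) (pairFlag H h)))
        exact flagFunctional_eq_of_iso e he k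
      rw [← he]
      simp [hd]
    · simp only [hd, false_and, if_false, mul_zero, Finset.sum_const_zero]
  have hfun : flagFunctional k H = ∑ h : Fin 2 ↪ V, if ∀ i j, h i ≠ H.root j then
        (features H.graph (H.root 0) (H.root 1) (h 0) (h 1) k : ℝ) else 0 := by
    rw [sum_embedding_eq_sum_ite fun g : Fin 2 → V => if ∀ i j, g i ≠ H.root j then
        (features H.graph (H.root 0) (H.root 1) (g 0) (g 1) k : ℝ) else 0]
    rw [sum_tuple_succ]
    simp only [sum_tuple_succ, flagFunctional]
    refine Finset.sum_congr rfl fun x _ => Finset.sum_congr rfl fun y _ => ?_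
    rw [Fintype.sum_unique]
    have hi : Function.Injective (Fin.cons x (Fin.cons y default) : Fin 2 → V) ↔ x ≠ y := by
      rw [Fin.cons_injective_iff]
      simp [Function.injective_of_subsingleton]
    simp only [hi, Fin.forall_fin_two (p := fun i => ∀ j, _)]
    by_cases hxy : x ≠ y
    · simp [hxy]
    · simp [hxy]
  have := hsum
  rw [hfun]
  have h2 : ∀ h : Fin 2 ↪ V, (if ∀ i j, h i ≠ H.root j then
        2 * (features H.graph (H.root 0) (H.root 1) (h 0) (h 1) k : ℝ) else 0) =
      2 * if ∀ i j, h i ≠ H.root j then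
        (features H.graph (H.root 0) (H.root 1) (h 0) (h 1) k : ℝ) else 0 := by
    intro h; split_ifs <;> simp
  simp only [h2, ← Finset.mul_sum] at this
  linarith

/-! ### The certificate -/

/-- Needed only to bound the contribution of degenerate tuples. The resulting 20000 · 6² = 720000 is
below 1290240, so the certificate has error constant 1. -/
theorem abs_boolProduct_le : ∀ r a₁ a₂ b₁ b₂ e c₁ c₂ d₁ d₂ f : Bool,
    |boolProduct r a₁ a₂ b₁ b₂ e c₁ c₂ d₁ d₂ f| ≤ 20000 := by
  decide +kernel

/-- The product of the features of two flags, as a real function of six vertices. -/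
def tupleProduct {V : Type*} (G : SimpleGraph V) (g : Fin 6 → V) : ℝ :=
  (flagProduct G (g 0) (g 1) (g 2) (g 3) (g 4) (g 5) : ℝ)

theorem abs_tupleProduct_le {V : Type*} (G : SimpleGraph V) (g : Fin 6 → V) :
    |tupleProduct G g| ≤ 20000 := by
  rw [tupleProduct, flagProduct_eq_boolProduct]
  exact_mod_cast abs_boolProduct_le _ _ _ _ _ _ _ _ _ _ _

theorem sum_flagProduct_perm {V : Type*} [Fintype V] (G : SimpleGraph V) (a b c d e f : Fin 6)
    (h : Function.Injective ![a, b, c, d, e, f]) :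
    ∑ g : Fin 6 ↪ V, (flagProduct G (g a) (g b) (g c) (g d) (g e) (g f) : ℝ) =
      ∑ g : Fin 6 ↪ V, tupleProduct G g := by
  let σ : Equiv.Perm (Fin 6) := Equiv.ofBijective _ (Finite.injective_iff_bijective.mp h)
  refine Fintype.sum_equiv (Equiv.embeddingCongr σ.symm (Equiv.refl V)) _ _ fun g => ?_
  rfl

theorem sum_matchingProduct_perm {V : Type*} [Fintype V] (G : SimpleGraph V)
    (a b c d e f : Fin 6) (h : Function.Injective ![a, b, c, d, e, f])
    (h' : Function.Injective ![a, b, c, e, d, f]) (h'' : Function.Injective ![a, b, c, f, d, e]) :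
    ∑ g : Fin 6 ↪ V, (matchingProduct G (g a) (g b) (g c) (g d) (g e) (g f) : ℝ) =
      3 * ∑ g : Fin 6 ↪ V, tupleProduct G g := by
  simp only [matchingProduct, Int.cast_add, Finset.sum_add_distrib]
  rw [sum_flagProduct_perm G _ _ _ _ _ _ h, sum_flagProduct_perm G _ _ _ _ _ _ h',
    sum_flagProduct_perm G _ _ _ _ _ _ h'']
  ring

theorem sum_sixSquares {V : Type*} [Fintype V] (G : SimpleGraph V) :
    ∑ g : Fin 6 ↪ V, (sixSquares G (g 0) (g 1) (g 2) (g 3) (g 4) (g 5) : ℝ) =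
      45 * ∑ g : Fin 6 ↪ V, tupleProduct G g := by
  simp only [sixSquares, Int.cast_add, Finset.sum_add_distrib]
  simp (disch := decide) only [sum_matchingProduct_perm]
  ring

/-- The condition on a pair of roots and two pairs of further vertices that the roots are distinct,
and that each pair of further vertices consists of distinct non-roots. -/
def PairsAdmissible {V : Type*} (g : Fin 6 → V) : Prop :=
  g 0 ≠ g 1 ∧ (g 2 ≠ g 3 ∧ (g 2 ≠ g 0 ∧ g 2 ≠ g 1) ∧ (g 3 ≠ g 0 ∧ g 3 ≠ g 1)) ∧
    (g 4 ≠ g 5 ∧ (g 4 ≠ g 0 ∧ g 4 ≠ g 1) ∧ (g 5 ≠ g 0 ∧ g 5 ≠ g 1))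

theorem PairsAdmissible.of_injective {V : Type*} {g : Fin 6 → V} (hg : Function.Injective g) :
    PairsAdmissible g := by
  simp [PairsAdmissible, hg.eq_iff]

-- Squaring yields two independent pairs over the same roots. They may overlap, so the condition on
-- six-tuples is weaker than injectivity.
open scoped Classical in
theorem sum_sq_flagFunctional {V : Type*} [Fintype V] (G : SimpleGraph V) :
    ∑ f : Fin 2 ↪ V, ∑ k, flagFunctional k (rootedAt G f) ^ 2 =
      ∑ g : Fin 6 → V, if PairsAdmissible g then tupleProduct G g else 0 := by
  let T : V → V → V → V → Fin 12 → ℝ := fun u v x y k =>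
    if x ≠ y ∧ (x ≠ u ∧ x ≠ v) ∧ (y ≠ u ∧ y ≠ v) then (features G u v x y k : ℝ) else 0
  have hT : ∀ (f : Fin 2 ↪ V) k, flagFunctional k (rootedAt G f) =
      ∑ x, ∑ y, T (f 0) (f 1) x y k := by
    intro f k
    simp only [flagFunctional, Fin.forall_fin_two]
    rfl
  simp only [hT]
  rw [sum_embedding_eq_sum_ite fun g : Fin 2 → V => ∑ k, (∑ x, ∑ y, T (g 0) (g 1) x y k) ^ 2]
  simp only [sum_tuple_succ, Fintype.sum_unique]
  refine Finset.sum_congr rfl fun u _ => Finset.sum_congr rfl fun v _ => ?_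
  have hi : Function.Injective (Fin.cons u (Fin.cons v default) : Fin 2 → V) ↔ u ≠ v := by
    rw [Fin.cons_injective_iff]
    simp [Function.injective_of_subsingleton]
  have hsq : ∀ k, (∑ x, ∑ y, T u v x y k) ^ 2 =
      ∑ x, ∑ y, ∑ x', ∑ y', T u v x y k * T u v x' y' k := by
    intro k
    rw [sq, ← Fintype.sum_prod_type' fun x y => T u v x y k, Fintype.sum_mul_sum,
      Fintype.sum_prod_type]
    simp only [Fintype.sum_prod_type]
  by_cases huv : u ≠ v
  · rw [if_pos (hi.mpr huv)]
    change ∑ k, (∑ x, ∑ y, T u v x y k) ^ 2 = _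
    simp only [hsq]
    rw [Finset.sum_comm]
    refine Finset.sum_congr rfl fun x _ => ?_
    rw [Finset.sum_comm]
    refine Finset.sum_congr rfl fun y _ => ?_
    rw [Finset.sum_comm]
    refine Finset.sum_congr rfl fun x' _ => ?_
    rw [Finset.sum_comm]
    refine Finset.sum_congr rfl fun y' _ => ?_
    trans if u ≠ v ∧ (x ≠ y ∧ (x ≠ u ∧ x ≠ v) ∧ (y ≠ u ∧ y ≠ v)) ∧
        (x' ≠ y' ∧ (x' ≠ u ∧ x' ≠ v) ∧ (y' ≠ u ∧ y' ≠ v)) then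
        (flagProduct G u v x y x' y' : ℝ) else 0
    swap
    · exact if_congr Iff.rfl rfl rfl
    simp only [huv, T, true_and, ne_eq, not_false_eq_true]
    by_cases h1 : ¬x = y ∧ (¬x = u ∧ ¬x = v) ∧ (¬y = u ∧ ¬y = v)
    · by_cases h2 : ¬x' = y' ∧ (¬x' = u ∧ ¬x' = v) ∧ (¬y' = u ∧ ¬y' = v)
      · simp only [if_pos h1, if_pos h2, if_pos (And.intro h1 h2), flagProduct]
        push_cast
        rfl
      · rw [if_neg fun h => h2 h.2]
        simp only [if_neg h2, mul_zero, Finset.sum_const_zero]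
    · rw [if_neg fun h => h1 h.1]
      simp only [if_neg h1, zero_mul, Finset.sum_const_zero]
  · rw [if_neg (mt hi.mp huv)]
    symm
    refine Finset.sum_eq_zero fun x _ => Finset.sum_eq_zero fun y _ => Finset.sum_eq_zero
      fun x' _ => Finset.sum_eq_zero fun y' _ => if_neg fun h => huv h.1

open scoped Classical in
theorem abs_sum_sq_flagFunctional_sub_le {V : Type*} [Fintype V] (G : SimpleGraph V) :
    |∑ f : Fin 2 ↪ V, ∑ k, flagFunctional k (rootedAt G f) ^ 2 -
      ∑ g : Fin 6 ↪ V, tupleProduct G g| ≤ 720000 * (Fintype.card V : ℝ) ^ 5 := by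
  rw [sum_sq_flagFunctional]
  refine (abs_sum_ite_sub_sum_embedding_le PairsAdmissible (fun g => .of_injective)
    (tupleProduct G) (by norm_num) (abs_tupleProduct_le G)).trans (le_of_eq ?_)
  push_cast
  ring

/-- The matrices of the certificate: only the types with two vertices occur. -/
def certificateMatrix : ∀ (q : ℕ) (τ : SimpleGraph (Fin q)),
    Matrix (FlagClass τ ((6 + q) / 2)) (FlagClass τ ((6 + q) / 2)) ℝ
  | 2, τ => (1 / 1290240 : ℝ) • ∑ k : Fin 12,
      Matrix.vecMulVec (fun F : FlagClass τ 4 => flagFunctional k F.out)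
        (fun F : FlagClass τ 4 => flagFunctional k F.out)
  | _, _ => 0

theorem certificateMatrix_posSemidef (q : ℕ) (τ : SimpleGraph (Fin q)) :
    (certificateMatrix q τ).PosSemidef := by
  unfold certificateMatrix
  split
  · refine Matrix.PosSemidef.smul (Matrix.posSemidef_sum _ fun k _ => ?_) (by norm_num)
    simpa using Matrix.posSemidef_vecMulVec_self_star
      (fun F : FlagClass _ 4 => flagFunctional k F.out)
  · exact Matrix.PosSemidef.zero

theorem certificateMatrix_eq_zero {q : ℕ} (hq : q ≠ 2) (τ : SimpleGraph (Fin q)) :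
    certificateMatrix q τ = 0 := by
  unfold certificateMatrix
  split
  · exact absurd rfl hq
  · rfl

/-- A graph on two vertices is determined by its one possible edge, so at most one type per
isomorphism class is automatic. -/
theorem eq_of_iso_fin_two {τ τ' : SimpleGraph (Fin 2)} (e : τ ≃g τ') : τ = τ' := by
  have h : ∀ τ : SimpleGraph (Fin 2), ∀ i j, τ.Adj i j ↔ i ≠ j ∧ τ.Adj 0 1 := by
    intro τ i j
    fin_cases i <;> fin_cases j <;> simp [τ.adj_comm 1 0]
  have h01 : τ.Adj 0 1 ↔ τ'.Adj 0 1 := by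
    rw [← e.map_adj_iff, h τ' (e 0)]
    simp
  ext i j
  rw [h τ, h τ', h01]

theorem dotProduct_certificateMatrix {V : Type*} [Fintype V] (G : SimpleGraph V)
    (f : Fin 2 ↪ V) :
    flagVector 4 (rootedAt G f) ⬝ᵥ
      (certificateMatrix 2 (G.comap f)).mulVec (flagVector 4 (rootedAt G f)) =
    1 / 1290240 * ∑ k, flagFunctional k (rootedAt G f) ^ 2 := by
  have h : ∀ k, (fun F : FlagClass (G.comap f) 4 => flagFunctional k F.out) ⬝ᵥ
      flagVector 4 (rootedAt G f) = flagFunctional k (rootedAt G f) := fun k =>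
    sum_flagFunctional_mul_flagCount (rootedAt G f) k
  simp only [certificateMatrix, Matrix.smul_mulVec, Matrix.sum_mulVec, Matrix.vecMulVec_mulVec,
    dotProduct_smul, dotProduct_sum, h, smul_eq_mul]
  congr 1
  refine Finset.sum_congr rfl fun k _ => ?_
  rw [dotProduct_comm]
  simp [h, sq]

theorem sixSquares_comap {V : Type*} (G : SimpleGraph V) (g : Fin 6 → V) :
    sixSquares (G.comap g) 0 1 2 3 4 5 = sixSquares G (g 0) (g 1) (g 2) (g 3) (g 4) (g 5) := rfl

theorem sixSquares_eq_of_iso {F H : SimpleGraph (Fin 6)} (e : F ≃g H) :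
    sixSquares F 0 1 2 3 4 5 = sixSquares H 0 1 2 3 4 5 := by
  have h : F = H.comap e := by
    ext i j
    exact e.map_adj_iff.symm
  rw [h, sixSquares_comap]
  exact comp_perm_of_swaps (sixSquares_swaps H) e.toEquiv id

/-- The slacks of the certificate. -/
def certificateSlack (F : GraphClass 6) : ℝ :=
  ((40320 - 5376 * sixSpan F.out 0 1 2 3 4 5 - sixSquares F.out 0 1 2 3 4 5 : ℤ) : ℝ) / 80640

theorem certificateSlack_nonneg (F : GraphClass 6) : 0 ≤ certificateSlack F := by
  refine div_nonneg (Int.cast_nonneg ?_) (by norm_num)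
  have := sixSquares_add_sixSpan_le F.out id
  simp only [id] at this
  linarith

theorem spanDensity_fin_six (F : SimpleGraph (Fin 6)) :
    spanDensity 4 3 F = (sixSpan F 0 1 2 3 4 5 : ℝ) / 15 := by
  rw [spanDensity, ← spanCount_fin_six]
  norm_num [Nat.choose]

/-- With 80640 = 15 · 5376, the slack cancels all but `sixSquares / 80640`. Passing to injections
divides by 720 and the symmetrisation multiplies by 45, whence 1290240 = 80640 · 720 / 45. -/
theorem sum_density_sub_slack {V : Type*} [Fintype V] (G : SimpleGraph V) :
    ∑ F : GraphClass 6, (1 / 2 - spanDensity 4 3 F.out) * (inducedCount F.out G : ℝ) -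
      ∑ F : GraphClass 6, certificateSlack F * (inducedCount F.out G : ℝ) =
    1 / 1290240 * ∑ g : Fin 6 ↪ V, tupleProduct G g := by
  have h1 := factorial_mul_sum_inducedCount
    (fun F : GraphClass 6 => (sixSquares F.out 0 1 2 3 4 5 : ℝ)) G
  have h2 : ∀ g : Fin 6 ↪ V, sixSquares
      (Quotient.mk (isoSetoid 6) (G.comap g)).out 0 1 2 3 4 5 =
      sixSquares G (g 0) (g 1) (g 2) (g 3) (g 4) (g 5) := by
    intro g
    obtain ⟨e⟩ := Quotient.exact (s := isoSetoid 6)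
      (Quotient.out_eq (Quotient.mk (isoSetoid 6) (G.comap g)))
    rw [sixSquares_eq_of_iso e, sixSquares_comap]
  simp only [h2, sum_sixSquares] at h1
  have h3 : ∀ F : GraphClass 6, (1 / 2 - spanDensity 4 3 F.out) * (inducedCount F.out G : ℝ) -
      certificateSlack F * (inducedCount F.out G : ℝ) =
      1 / 80640 * ((sixSquares F.out 0 1 2 3 4 5 : ℝ) * (inducedCount F.out G : ℝ)) := by
    intro F
    rw [spanDensity_fin_six, certificateSlack]
    push_cast
    ring
  rw [← Finset.sum_sub_distrib, Finset.sum_congr rfl fun F _ => h3 F, ← Finset.mul_sum]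
  norm_num [Nat.factorial] at h1 ⊢
  linarith

theorem hasFlagCertificate : HasFlagCertificate 4 3 6 (1 / 2) := by
  refine ⟨by norm_num, certificateMatrix, certificateSlack, certificateMatrix_posSemidef, ?_,
    certificateSlack_nonneg, 1, ?_⟩
  · rintro q τ τ' hne ⟨e⟩
    by_cases hq : q = 2
    · subst hq
      exact absurd (eq_of_iso_fin_two e) hne
    · exact Or.inl (certificateMatrix_eq_zero hq τ)
  · intro n G
    have hq : (Finset.Icc 1 (6 - 2)).filter (fun q => q ≡ 6 [MOD 2]) = {2, 4} := by decide
    have h4 : ∀ f : Fin 4 ↪ Fin n, flagVector ((6 + 4) / 2) (rootedAt G f) ⬝ᵥ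
        (certificateMatrix 4 (G.comap f)).mulVec (flagVector ((6 + 4) / 2) (rootedAt G f)) = 0 := by
      intro f
      rw [certificateMatrix_eq_zero (by norm_num)]
      simp
    have h2 : ∀ f : Fin 2 ↪ Fin n, flagVector ((6 + 2) / 2) (rootedAt G f) ⬝ᵥ
        (certificateMatrix 2 (G.comap f)).mulVec (flagVector ((6 + 2) / 2) (rootedAt G f)) =
        1 / 1290240 * ∑ k, flagFunctional k (rootedAt G f) ^ 2 :=
      fun f => dotProduct_certificateMatrix G f
    rw [hq, Finset.sum_pair (by norm_num)]
    simp only [h4, h2, Finset.sum_const_zero, add_zero]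
    rw [← Finset.mul_sum, sub_add_eq_sub_sub_swap, sum_density_sub_slack, ← mul_sub, abs_mul,
      abs_sub_comm]
    have h := abs_sum_sq_flagFunctional_sub_le G
    rw [Fintype.card_fin] at h
    have hn : (0 : ℝ) ≤ (n : ℝ) ^ 5 := by positivity
    rw [abs_of_pos (by norm_num : (0 : ℝ) < 1 / 1290240)]
    norm_num
    linarith

/-! ### The upper bound on the number of quadruples with three edges -/

theorem sum_tuple_perm {V : Type*} [Fintype V] (h : (Fin 6 → V) → ℝ) {w : Fin 6 → Fin 6}
    (hw : Function.Injective w) : ∑ g : Fin 6 → V, h (g ∘ w) = ∑ g : Fin 6 → V, h g := by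
  let σ : Equiv.Perm (Fin 6) := Equiv.ofBijective _ (Finite.injective_iff_bijective.mp hw)
  exact Fintype.sum_equiv (Equiv.arrowCongr σ.symm (Equiv.refl V)) _ _ fun g => rfl

/-- Without any distinctness condition the two pairs range independently, so for each choice of
roots the sum is exactly a sum of twelve squares. -/
theorem sum_flagProduct_tuple_nonneg {V : Type*} [Fintype V] (G : SimpleGraph V)
    (a b c d e f : Fin 6) (h : Function.Injective ![a, b, c, d, e, f]) :
    0 ≤ ∑ g : Fin 6 → V, (flagProduct G (g a) (g b) (g c) (g d) (g e) (g f) : ℝ) := by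
  have h1 := sum_tuple_perm (tupleProduct G) h
  refine le_of_le_of_eq ?_ h1.symm
  have h2 : ∀ u v, ∑ x, ∑ y, ∑ x', ∑ y', (flagProduct G u v x y x' y' : ℝ) =
      ∑ k, (∑ x, ∑ y, (features G u v x y k : ℝ)) ^ 2 := by
    intro u v
    simp only [flagProduct, Int.cast_sum, Int.cast_mul]
    have h3 : ∀ k, (∑ x, ∑ y, (features G u v x y k : ℝ)) ^ 2 =
        ∑ x, ∑ y, ∑ x', ∑ y', (features G u v x y k : ℝ) * features G u v x' y' k := by
      intro k
      rw [sq, ← Fintype.sum_prod_type' fun x y => (features G u v x y k : ℝ), Fintype.sum_mul_sum,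
        Fintype.sum_prod_type]
      simp only [Fintype.sum_prod_type]
    simp only [h3]
    symm
    rw [Finset.sum_comm]
    refine Finset.sum_congr rfl fun x _ => ?_
    rw [Finset.sum_comm]
    refine Finset.sum_congr rfl fun y _ => ?_
    rw [Finset.sum_comm]
    refine Finset.sum_congr rfl fun x' _ => ?_
    rw [Finset.sum_comm]
  simp only [sum_tuple_succ, Fintype.sum_unique]
  refine Finset.sum_nonneg fun u _ => Finset.sum_nonneg fun v _ => ?_
  refine le_of_le_of_eq (Finset.sum_nonneg fun k _ => sq_nonneg _) (h2 u v).symm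

theorem sum_sixSquares_tuple_nonneg {V : Type*} [Fintype V] (G : SimpleGraph V) :
    0 ≤ ∑ g : Fin 6 → V, (sixSquares G (g 0) (g 1) (g 2) (g 3) (g 4) (g 5) : ℝ) := by
  have h : ∀ a b c d e f : Fin 6, Function.Injective ![a, b, c, d, e, f] →
      Function.Injective ![a, b, c, e, d, f] → Function.Injective ![a, b, c, f, d, e] →
      0 ≤ ∑ g : Fin 6 → V, (matchingProduct G (g a) (g b) (g c) (g d) (g e) (g f) : ℝ) := by
    intro a b c d e f h h' h''
    simp only [matchingProduct, Int.cast_add, Finset.sum_add_distrib]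
    exact add_nonneg (add_nonneg (sum_flagProduct_tuple_nonneg G _ _ _ _ _ _ h)
      (sum_flagProduct_tuple_nonneg G _ _ _ _ _ _ h'))
      (sum_flagProduct_tuple_nonneg G _ _ _ _ _ _ h'')
  simp only [sixSquares, Int.cast_add, Finset.sum_add_distrib]
  repeat' apply add_nonneg
  all_goals exact h _ _ _ _ _ _ (by decide) (by decide) (by decide)

/-- The two unused coordinates are moved to the front, where each contributes a free factor
`Fintype.card V`. -/
theorem sum_spanThree_tuple {V : Type*} [Fintype V] (G : SimpleGraph V)
    (a b c d e f : Fin 6) (h : Function.Injective ![a, b, c, d, e, f]) :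
    ∑ g : Fin 6 → V, (spanThree G (g a) (g b) (g c) (g d) : ℝ) = (Fintype.card V : ℝ) ^ 2 *
      ∑ g : Fin 4 → V, (spanThree G (g 0) (g 1) (g 2) (g 3) : ℝ) := by
  have h1 := sum_tuple_perm
    (fun g : Fin 6 → V => (spanThree G (g 2) (g 3) (g 4) (g 5) : ℝ))
    (w := ![e, f, a, b, c, d]) (by
      have h2 : ![e, f, a, b, c, d] = ![a, b, c, d, e, f] ∘ ![4, 5, 0, 1, 2, 3] := by
        funext i
        fin_cases i <;> rfl
      rw [h2]
      exact h.comp (by decide))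
  refine h1.trans ?_
  rw [sum_tuple_succ]
  simp only [sum_tuple_succ (k := 4)]
  change ∑ _ : V, ∑ _ : V, ∑ g : Fin 4 → V, (spanThree G (g 0) (g 1) (g 2) (g 3) : ℝ) = _
  simp only [Finset.sum_const, Finset.card_univ, nsmul_eq_mul]
  ring

theorem sum_sixSpan_tuple {V : Type*} [Fintype V] (G : SimpleGraph V) :
    ∑ g : Fin 6 → V, (sixSpan G (g 0) (g 1) (g 2) (g 3) (g 4) (g 5) : ℝ) =
      15 * ((Fintype.card V : ℝ) ^ 2 *
        ∑ g : Fin 4 → V, (spanThree G (g 0) (g 1) (g 2) (g 3) : ℝ)) := by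
  simp only [sixSpan, Int.cast_add, Finset.sum_add_distrib]
  rw [sum_spanThree_tuple G 0 1 2 3 4 5 (by decide),
    sum_spanThree_tuple G 0 1 2 4 3 5 (by decide),
    sum_spanThree_tuple G 0 1 2 5 3 4 (by decide),
    sum_spanThree_tuple G 0 1 3 4 2 5 (by decide),
    sum_spanThree_tuple G 0 1 3 5 2 4 (by decide),
    sum_spanThree_tuple G 0 1 4 5 2 3 (by decide),
    sum_spanThree_tuple G 0 2 3 4 1 5 (by decide),
    sum_spanThree_tuple G 0 2 3 5 1 4 (by decide),
    sum_spanThree_tuple G 0 2 4 5 1 3 (by decide),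
    sum_spanThree_tuple G 0 3 4 5 1 2 (by decide),
    sum_spanThree_tuple G 1 2 3 4 0 5 (by decide),
    sum_spanThree_tuple G 1 2 3 5 0 4 (by decide),
    sum_spanThree_tuple G 1 2 4 5 0 3 (by decide),
    sum_spanThree_tuple G 1 3 4 5 0 2 (by decide),
    sum_spanThree_tuple G 2 3 4 5 0 1 (by decide)]
  ring

theorem spanThree_nonneg {V : Type*} (G : SimpleGraph V) (a b c d : V) :
    0 ≤ spanThree G a b c d := by
  rw [spanThree, boolThree_eq_ite]
  split_ifs <;> norm_num

/-- Degenerate quadruples contribute nonnegatively, so enlarging the sum from injections to all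
tuples loses nothing in this direction. -/
theorem spanCount_le {V : Type*} [Fintype V] (G : SimpleGraph V) :
    48 * (spanCount 4 3 G : ℝ) ≤ (Fintype.card V : ℝ) ^ 4 := by
  classical
  have h1 : 24 * (spanCount 4 3 G : ℝ) ≤
      ∑ g : Fin 4 → V, (spanThree G (g 0) (g 1) (g 2) (g 3) : ℝ) := by
    rw [factorial_mul_spanCount, sum_embedding_eq_sum_ite
      fun g : Fin 4 → V => (spanThree G (g 0) (g 1) (g 2) (g 3) : ℝ)]
    refine Finset.sum_le_sum fun g _ => ?_
    have := spanThree_nonneg G (g 0) (g 1) (g 2) (g 3)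
    split_ifs
    · exact le_rfl
    · exact_mod_cast this
  have h2 : ∑ g : Fin 6 → V, ((sixSquares G (g 0) (g 1) (g 2) (g 3) (g 4) (g 5) : ℝ) +
      5376 * (sixSpan G (g 0) (g 1) (g 2) (g 3) (g 4) (g 5) : ℝ)) ≤
      ∑ _g : Fin 6 → V, (40320 : ℝ) :=
    Finset.sum_le_sum fun g _ => by exact_mod_cast sixSquares_add_sixSpan_le G g
  rw [Finset.sum_add_distrib, ← Finset.mul_sum, sum_sixSpan_tuple] at h2
  simp only [Finset.sum_const, Finset.card_univ, Fintype.card_fun, Fintype.card_fin,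
    nsmul_eq_mul, Nat.cast_pow] at h2
  have h3 := sum_sixSquares_tuple_nonneg G
  -- The final cancellation of n² needs n > 0.
  rcases Nat.eq_zero_or_pos (Fintype.card V) with h0 | h0
  · have : spanCount 4 3 G = 0 := by
      rw [spanCount, Finset.powersetCard_eq_empty.mpr (by simp [h0])]
      simp
    simp [this, h0]
  · have hn : (0 : ℝ) < (Fintype.card V : ℝ) ^ 2 := by positivity
    have h4 : (Fintype.card V : ℝ) ^ 2 * (48 * (spanCount 4 3 G : ℝ)) ≤
        (Fintype.card V : ℝ) ^ 2 * (Fintype.card V : ℝ) ^ 4 := by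
      have := mul_le_mul_of_nonneg_left h1 hn.le
      nlinarith
    exact le_of_mul_le_mul_left h4 hn

/-! ### Densities of blowups -/

/-- The sign of a colour. -/
def colourSign (i : Fin 2) : ℤ := if i = 0 then 1 else -1

/-- A 3–1 split gives a triangle plus a vertex, or a star; a 4–0 split gives 6 or 0 edges and a 2–2
split gives 2 or 4. -/
theorem two_mul_spanThree_blowup {V : Type*} {B : Pattern 2} (hB : B = twoLoops ∨ B = singleEdge)
    (c : V → Fin 2) (g : Fin 4 ↪ V) :
    2 * spanThree (B.blowup c) (g 0) (g 1) (g 2) (g 3) =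
      1 - ∏ i, colourSign (c (g i)) := by
  have hne : ∀ i j : Fin 4, i ≠ j → g i ≠ g j := fun i j h => g.injective.ne h
  rw [Fin.prod_univ_four, spanThree]
  rcases hB with rfl | rfl
  · have h : ∀ p q r s : Fin 2, 2 * boolThree (decide (p = q)) (decide (p = r)) (decide (p = s))
        (decide (q = r)) (decide (q = s)) (decide (r = s)) =
        1 - colourSign p * colourSign q * colourSign r * colourSign s := by decide
    have ha : ∀ i j : Fin 4, i ≠ j → adjBool (twoLoops.blowup c) (g i) (g j) =
        decide (c (g i) = c (g j)) := by
      intro i j hij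
      simp [adjBool, Pattern.blowup, twoLoops, hij]
    rw [← h, ha 0 1 (by decide), ha 0 2 (by decide), ha 0 3 (by decide), ha 1 2 (by decide),
      ha 1 3 (by decide), ha 2 3 (by decide)]
  · have h : ∀ p q r s : Fin 2, 2 * boolThree (decide (p ≠ q)) (decide (p ≠ r)) (decide (p ≠ s))
        (decide (q ≠ r)) (decide (q ≠ s)) (decide (r ≠ s)) =
        1 - colourSign p * colourSign q * colourSign r * colourSign s := by decide
    have ha : ∀ i j : Fin 4, i ≠ j → adjBool (singleEdge.blowup c) (g i) (g j) =
        decide (c (g i) ≠ c (g j)) := by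
      intro i j hij
      simp [adjBool, Pattern.blowup, singleEdge, hij]
    rw [← h, ha 0 1 (by decide), ha 0 2 (by decide), ha 0 3 (by decide), ha 1 2 (by decide),
      ha 1 3 (by decide), ha 2 3 (by decide)]

theorem abs_colourSign (i : Fin 2) : |(colourSign i : ℝ)| = 1 := by
  rw [colourSign]
  split_ifs <;> norm_num

/-- Over all tuples the product of signs sums to the fourth power of the sign sum. Degenerate tuples
have terms of size at most 2, which gives 32 = 2 · 4². -/
theorem abs_spanCount_blowup_sub_le {V : Type*} [Fintype V] {B : Pattern 2}
    (hB : B = twoLoops ∨ B = singleEdge) (c : V → Fin 2) :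
    |(Fintype.card V : ℝ) ^ 4 - (∑ v, (colourSign (c v) : ℝ)) ^ 4 -
      48 * (spanCount 4 3 (B.blowup c) : ℝ)| ≤ 32 * (Fintype.card V : ℝ) ^ 3 := by
  classical
  have h1 : 48 * (spanCount 4 3 (B.blowup c) : ℝ) =
      ∑ g : Fin 4 ↪ V, (1 - ∏ i, (colourSign (c (g i)) : ℝ)) := by
    rw [show (48 : ℝ) = 2 * 24 by norm_num, mul_assoc, factorial_mul_spanCount, Finset.mul_sum]
    exact Finset.sum_congr rfl fun g _ => by exact_mod_cast two_mul_spanThree_blowup hB c g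
  have h2 := abs_sum_ite_sub_sum_embedding_le (V := V) (k := 3) (fun _ => True) (fun _ _ => trivial)
    (fun g => 1 - ∏ i, (colourSign (c (g i)) : ℝ)) (M := 2) (by norm_num) (fun g => by
      refine (abs_sub _ _).trans ?_
      rw [Finset.abs_prod]
      simp only [abs_colourSign, Finset.prod_const_one]
      norm_num)
  simp only [if_true, Finset.sum_sub_distrib (f := fun _ : Fin 4 → V => (1 : ℝ)),
    Finset.sum_const, Finset.card_univ, Fintype.card_fun, Fintype.card_fin, nsmul_eq_mul,
    Nat.cast_pow, mul_one] at h2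
  rw [h1, Fintype.sum_pow]
  refine h2.trans (le_of_eq ?_)
  norm_num
  ring

theorem tendsto_descFactorial_div_pow :
    Tendsto (fun n : ℕ => (n.descFactorial 4 : ℝ) / (n : ℝ) ^ 4) atTop (𝓝 1) := by
  have h1 : Tendsto (fun n : ℕ => 1 - (16 : ℝ) / n) atTop (𝓝 1) := by
    simpa using (tendsto_const_div_atTop_nhds_zero_nat (16 : ℝ)).const_sub 1
  refine tendsto_of_tendsto_of_tendsto_of_le_of_le' h1 tendsto_const_nhds ?_ ?_
  · filter_upwards [eventually_gt_atTop 0] with n hn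
    have hn' : (0 : ℝ) < n := by exact_mod_cast hn
    have h2 := pow_sub_descFactorial_le n 3
    rw [le_div_iff₀ (by positivity)]
    have h3 : (1 - (16 : ℝ) / n) * (n : ℝ) ^ 4 = (n : ℝ) ^ 4 - 16 * (n : ℝ) ^ 3 := by
      field_simp
    rw [h3]
    norm_num at h2 ⊢
    linarith
  · filter_upwards with n
    refine div_le_one_of_le₀ ?_ (by positivity)
    exact_mod_cast n.descFactorial_le_pow 4

/-- For 0 < n < 4 both sides are 0, because division by zero yields 0. -/
theorem div_choose_four (a : ℝ) {n : ℕ} (hn : 0 < n) : a / (n.choose 4 : ℝ) =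
    24 * a / (n : ℝ) ^ 4 / ((n.descFactorial 4 : ℝ) / (n : ℝ) ^ 4) := by
  have hn' : (n : ℝ) ≠ 0 := by exact_mod_cast hn.ne'
  rw [div_div_div_cancel_right₀ (pow_ne_zero 4 hn'), Nat.descFactorial_eq_factorial_mul_choose]
  push_cast
  rw [show ((4 : ℕ).factorial : ℝ) = 24 by norm_num [Nat.factorial],
    mul_div_mul_left _ _ (by norm_num)]

theorem sum_colourSign {V : Type*} [Fintype V] (c : V → Fin 2) :
    ∑ v, (colourSign (c v) : ℝ) = ((Finset.univ.filter fun v => c v = 0).card : ℝ) -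
      ((Finset.univ.filter fun v => c v = 1).card : ℝ) := by
  rw [Finset.card_filter, Finset.card_filter, Nat.cast_sum, Nat.cast_sum,
    ← Finset.sum_sub_distrib]
  refine Finset.sum_congr rfl fun v _ => ?_
  generalize c v = i
  fin_cases i <;> simp [colourSign]

/-- The density of the blowups of either pattern with parts of sizes `x 0` and `x 1`. -/
def blowupDensity (x : Fin 2 → ℝ) : ℝ := (1 - (x 0 - x 1) ^ 4) / 2

theorem isBlowupDensity {B : Pattern 2} (hB : B = twoLoops ∨ B = singleEdge) (x : Fin 2 → ℝ) :
    IsBlowupDensity 4 3 B x (blowupDensity x) := by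
  intro c hc
  have h1 : Tendsto (fun n : ℕ => (1 - ((∑ v, (colourSign (c n v) : ℝ)) / n) ^ 4))
      atTop (𝓝 (1 - (x 0 - x 1) ^ 4)) := by
    refine (Tendsto.pow ?_ 4).const_sub 1
    simp only [sum_colourSign, sub_div]
    exact (hc 0).sub (hc 1)
  have h2 : Tendsto (fun n : ℕ => 48 * (spanCount 4 3 (B.blowup (c n)) : ℝ) / (n : ℝ) ^ 4)
      atTop (𝓝 (1 - (x 0 - x 1) ^ 4)) := by
    refine h1.congr_dist ?_
    refine squeeze_zero' (Eventually.of_forall fun _ => dist_nonneg) ?_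
      (tendsto_const_div_atTop_nhds_zero_nat (32 : ℝ))
    filter_upwards [eventually_gt_atTop 0] with n hn
    have hn' : (0 : ℝ) < n := by exact_mod_cast hn
    have h := abs_spanCount_blowup_sub_le hB (c n)
    rw [Fintype.card_fin] at h
    have e : 1 - ((∑ v, (colourSign (c n v) : ℝ)) / n) ^ 4 -
        48 * (spanCount 4 3 (B.blowup (c n)) : ℝ) / (n : ℝ) ^ 4 =
        ((n : ℝ) ^ 4 - (∑ v, (colourSign (c n v) : ℝ)) ^ 4 -
          48 * (spanCount 4 3 (B.blowup (c n)) : ℝ)) / (n : ℝ) ^ 4 := by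
      field_simp
    rw [Real.dist_eq, e, abs_div, abs_of_pos (by positivity : (0 : ℝ) < (n : ℝ) ^ 4),
      div_le_div_iff₀ (by positivity) hn']
    nlinarith
  have h3 := (h2.div_const 2).div tendsto_descFactorial_div_pow one_ne_zero
  rw [div_one] at h3
  refine h3.congr' ?_
  filter_upwards [eventually_gt_atTop 0] with n hn
  rw [spanDensity, Fintype.card_fin, div_choose_four _ hn, Pi.div_apply]
  congr 1
  ring

theorem blowupDensity_lt {x : Fin 2 → ℝ} (hx : x ∈ stdSimplex ℝ (Fin 2))
    (hne : x ≠ ![1 / 2, 1 / 2]) : blowupDensity x < 1 / 2 := by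
  have hs : x 0 + x 1 = 1 := by simpa using hx.2
  have h : x 0 - x 1 ≠ 0 := by
    intro h
    apply hne
    funext i
    fin_cases i
    · change x 0 = 1 / 2
      linarith
    · change x 1 = 1 / 2
      linarith
  have : 0 < (x 0 - x 1) ^ 4 := by positivity
  rw [blowupDensity]
  linarith

/-! ### The inducibility constant -/

/-- The colouring of `{0, …, n-1}` with two colour classes of almost equal sizes. -/
def halfColouring (n : ℕ) (v : Fin n) : Fin 2 := if (v : ℕ) < n / 2 then 0 else 1

theorem tendsto_halfColouring (i : Fin 2) : Tendsto (fun n : ℕ =>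
    ((Finset.univ.filter fun v : Fin n => halfColouring n v = i).card : ℝ) / (n : ℝ)) atTop
    (𝓝 (1 / 2)) := by
  have h0 : ∀ n, (Finset.univ.filter fun v : Fin n => halfColouring n v = 0).card = n / 2 := by
    intro n
    have : (Finset.univ.filter fun v : Fin n => halfColouring n v = 0) =
        Finset.univ.filter fun v : Fin n => (v : ℕ) < n / 2 :=
      Finset.filter_congr fun v _ => by simp [halfColouring]
    rw [this, Fin.card_filter_val_lt]
    omega
  have h1 : ∀ n, (Finset.univ.filter fun v : Fin n => halfColouring n v = 1).card =
      n - n / 2 := by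
    intro n
    have h := Finset.card_filter_add_card_filter_not (s := (Finset.univ : Finset (Fin n)))
      fun v => halfColouring n v = 0
    have : (Finset.univ.filter fun v : Fin n => halfColouring n v = 1) =
        Finset.univ.filter fun v : Fin n => ¬halfColouring n v = 0 :=
      Finset.filter_congr fun v _ => by omega
    rw [h0, ← this, Finset.card_univ, Fintype.card_fin] at h
    omega
  rw [tendsto_iff_dist_tendsto_zero]
  refine squeeze_zero' (Eventually.of_forall fun _ => dist_nonneg) ?_
    (tendsto_const_div_atTop_nhds_zero_nat (1 : ℝ))
  filter_upwards [eventually_gt_atTop 0] with n hn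
  have hn' : (0 : ℝ) < n := by exact_mod_cast hn
  have hd : ∀ m : ℕ, 2 * m ≤ n + 1 → n ≤ 2 * m + 1 → dist ((m : ℝ) / n) (1 / 2) ≤ 1 / n := by
    intro m h h'
    have h2 : 2 * (m : ℝ) ≤ n + 1 := by exact_mod_cast h
    have h3 : (n : ℝ) ≤ 2 * m + 1 := by exact_mod_cast h'
    rw [Real.dist_eq, show (m : ℝ) / n - 1 / 2 = (2 * m - n) / 2 / n by field_simp, abs_div,
      abs_of_pos hn']
    refine div_le_div_of_nonneg_right ?_ hn'.le
    rw [abs_le]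
    constructor <;> linarith
  fin_cases i
  · simp only [Fin.zero_eta, h0]
    exact hd _ (by omega) (by omega)
  · simp only [Fin.mk_one, h1]
    exact hd _ (by omega) (by omega)

/-- Squeeze between balanced unions of two cliques and the bound n^4/48, whose ratio to the binomial
coefficient tends to 1/2. -/
theorem isEdgeInducibilityConstant : IsEdgeInducibilityConstant 4 3 (1 / 2) := by
  classical
  have hlow : Tendsto (fun n : ℕ => spanDensity 4 3 (twoLoops.blowup (halfColouring n))) atTop
      (𝓝 (1 / 2)) := by
    have h := isBlowupDensity (Or.inl rfl : twoLoops = twoLoops ∨ _) (fun _ => 1 / 2)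
      halfColouring tendsto_halfColouring
    simpa [blowupDensity] using h
  have hup : Tendsto (fun n : ℕ => 1 / 2 / ((n.descFactorial 4 : ℝ) / (n : ℝ) ^ 4)) atTop
      (𝓝 (1 / 2)) := by
    have h := (tendsto_const_nhds (x := (1 / 2 : ℝ))).div tendsto_descFactorial_div_pow one_ne_zero
    rwa [div_one] at h
  refine tendsto_of_tendsto_of_tendsto_of_le_of_le' hlow hup ?_ ?_
  · refine Eventually.of_forall fun n => ?_
    rw [spanDensity, maxSpanDensity, Fintype.card_fin]
    refine div_le_div_of_nonneg_right ?_ (Nat.cast_nonneg _)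
    exact_mod_cast Finset.le_sup (f := fun G : SimpleGraph (Fin n) => spanCount 4 3 G)
      (Finset.mem_univ _)
  · filter_upwards [eventually_gt_atTop 0] with n hn
    have hn' : (0 : ℝ) < n := by exact_mod_cast hn
    rw [maxSpanDensity, div_choose_four _ hn]
    refine div_le_div_of_nonneg_right ?_ (by positivity)
    obtain ⟨G, -, hG⟩ := Finset.exists_mem_eq_sup (Finset.univ : Finset (SimpleGraph (Fin n)))
      Finset.univ_nonempty fun G => spanCount 4 3 G
    rw [maxSpanCount, hG, div_le_iff₀ (by positivity)]
    have h := spanCount_le G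
    rw [Fintype.card_fin] at h
    linarith

end
end EdgeInd

theorem theorem3p3 :
    EdgeInd.IsEdgeInducibilityConstant 4 3 (1 / 2) ∧
    (∀ B : EdgeInd.Pattern 2, B = EdgeInd.twoLoops ∨ B = EdgeInd.singleEdge →
      ∃ p : (Fin 2 → ℝ) → ℝ,
        (∀ x ∈ stdSimplex ℝ (Fin 2), EdgeInd.IsBlowupDensity 4 3 B x (p x)) ∧
        p ![1 / 2, 1 / 2] = 1 / 2 ∧
        ∀ x ∈ stdSimplex ℝ (Fin 2), x ≠ ![1 / 2, 1 / 2] → p x < 1 / 2) ∧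
    EdgeInd.HasFlagCertificate 4 3 6 (1 / 2) :=
  ⟨EdgeInd.isEdgeInducibilityConstant,
    fun _ hB => ⟨EdgeInd.blowupDensity, fun x _ => EdgeInd.isBlowupDensity hB x,
      by simp [EdgeInd.blowupDensity], fun _ hx hne => EdgeInd.blowupDensity_lt hx hne⟩,
    EdgeInd.hasFlagCertificate⟩
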